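/- Let $k$ be an algebraically closed field, $R=k[x,y,z]$ the homogeneous coordinate ring of $\mathbf P^2$ over $k$, $n\ge 1$, and $\mathbf m=(m_1,\dots,m_n)$ an $n$-tuple of nonnegative integers. For points $p_1,\dots,p_n\in\mathbf P^2$ with homogeneous ideals $P_1,\dots,P_n\subset R$ put $I(\mathbf m;n)=P_1^{m_1}\cap\cdots\cap P_n^{m_n}$, and for a homogeneous ideal $I$ let $h_I(t)=\dim_k I_t$ (so $h_I(t)=0$ for $t<0$). Let $\alpha=\alpha(\mathbf m;n)$ be the least $t$ with $I(\mathbf m;n)_t\neq 0$, and let $h=h_{I(\mathbf m;n)}(\alpha)$. The ideal $I(\mathbf m;n)$ is *unhindered* if $$h_{I(\mathbf m;n)}(t)=\max\Bigl\{0,\tfrac12\Bigl((t+1)(t+2)-\sum_{i=1}^n m_i(m_i+1)\Bigr)\Bigr\}\quad\text{for all } t\ge 0,$$ and it is *rank minimal* if it is unhindered and the free module $F_0$ in its minimal graded free resolution $0\to F_1\to F_0\to I(\mathbf m;n)\to 0$ over $R$ has rank $\max\{h,\alpha+2-h\}$. Let $\mathbf m'=(m_1+1,m_2,\dots,m_n)$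 and $\mathbf m''=(m_1-1,m_2,\dots,m_n)$, where $m_1-1$ is read as $0$ if $m_1=0$; write $I'=I(\mathbf m';n)$ and $I''=I(\mathbf m'';n)$ (for the same points), and put $$q=h_{I'}(\alpha),\qquad l=h_{I''}(\alpha-1).$$ Then for general points $p_1,\dots,p_n$ (that is, for all $(p_1,\dots,p_n)$ in some nonempty Zariski open subset of $(\mathbf P^2)^n$, which may depend on $\mathbf m$) the following holds. Assume that $I(\mathbf m;n)$ is unhindered. (a) If $q=0$ and $l=0$, then $I(\mathbf m;n)$ is rank minimal. (b) If $n\ge 2$, $m_1=m_2$ and $q=0$, then $I(\mathbf m;n)$ is rank minimal. (c) If $n\ge 2$, $m_1=m_2$, $l>0$, and $I'$ and $I''$ are unhindered, then $I(\mathbf m;n)$ is rank minimal. -/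

import Mathlib

/-! Fat point ideals of points of the projective plane over a field, their Hilbert functions and
their minimal graded free resolutions. -/

namespace FatPoints

universe u

/-- The homogeneous coordinate ring `k[x, y, z]` of the projective plane over `k`. -/
abbrev Ring3 (k : Type u) [Field k] : Type u := MvPolynomial (Fin 3) k

/-- The projective plane over `k`: the lines through the origin in `k ^ 3`. -/
abbrev Plane (k : Type u) [Field k] : Type u := Projectivization k (Fin 3 → k)

variable {k : Type u} [Field k]

/-- The homogeneous ideal of a point of the plane, generated by all forms vanishing at the
point. (For a form, vanishing does not depend on the representative of the point.) -/
noncomputable def pointIdeal (p : Plane k) : Ideal (Ring3 k) :=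
  Ideal.span {f | ∃ d : ℕ, f.IsHomogeneous d ∧ MvPolynomial.eval p.rep f = 0}

/-- The ideal `P₁ ^ m₁ ∩ ⋯ ∩ Pₙ ^ mₙ` of the fat point subscheme `m₁ p₁ + ⋯ + mₙ pₙ`. -/
noncomputable def fatIdeal {n : ℕ} (p : Fin n → Plane k) (m : Fin n → ℕ) : Ideal (Ring3 k) :=
  ⨅ i, pointIdeal (p i) ^ m i

/-- The degree `t` component `I_t` of an ideal: the forms of degree `t` in `I`. -/
noncomputable def component (I : Ideal (Ring3 k)) (t : ℕ) : Submodule k (Ring3 k) :=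
  MvPolynomial.homogeneousSubmodule (Fin 3) k t ⊓ I.restrictScalars k

/-- The Hilbert function `t ↦ dim_k I_t`. -/
noncomputable def hilb (I : Ideal (Ring3 k)) (t : ℕ) : ℕ :=
  Module.finrank k (component I t)

/-- The least degree `t` such that `I_t ≠ 0`. -/
noncomputable def alpha (I : Ideal (Ring3 k)) : ℕ :=
  sInf {t | component I t ≠ ⊥}

/-- `m' = (m₁ + 1, m₂, …, mₙ)`. -/
def mPrime {n : ℕ} [NeZero n] (m : Fin n → ℕ) : Fin n → ℕ :=
  Function.update m 0 (m 0 + 1)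

/-- `m'' = (m₁ - 1, m₂, …, mₙ)`. If `m₁ = 0`, the first entry is read as `0`: a multiplicity `-1`
imposes no condition, just as the multiplicity `0`, and `(-1) * (-1 + 1) = 0 = 0 * (0 + 1)`. -/
def mDoublePrime {n : ℕ} [NeZero n] (m : Fin n → ℕ) : Fin n → ℕ :=
  Function.update m 0 (m 0 - 1)

/-- `h_I(t) = max {0, ((t + 1)(t + 2) - ∑ mᵢ (mᵢ + 1)) / 2}` for all `t ≥ 0`, for the ideal `I` of
`m₁ p₁ + ⋯ + mₙ pₙ`. (The numerator is even, so the integer division is exact.) -/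
def Unhindered {n : ℕ} (p : Fin n → Plane k) (m : Fin n → ℕ) : Prop :=
  ∀ t : ℕ, (hilb (fatIdeal p m) t : ℤ) =
    max 0 ((((t : ℤ) + 1) * ((t : ℤ) + 2) - ∑ i, (m i : ℤ) * ((m i : ℤ) + 1)) / 2)

/-- `q(m; n)`: the value at `α(m; n)` of the Hilbert function of the ideal with multiplicities
`m'`. -/
noncomputable def qNum {n : ℕ} [NeZero n] (p : Fin n → Plane k) (m : Fin n → ℕ) : ℕ :=
  hilb (fatIdeal p (mPrime m)) (alpha (fatIdeal p m))

/-- `l(m; n)`: the value at `α(m; n) - 1` of the Hilbert function of the ideal with multiplicities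
`m''`. There are no nonzero forms of degree `-1`, so it is `0` if `α(m; n) = 0`. -/
noncomputable def lNum {n : ℕ} [NeZero n] (p : Fin n → Plane k) (m : Fin n → ℕ) : ℕ :=
  if alpha (fatIdeal p m) = 0 then 0
  else hilb (fatIdeal p (mDoublePrime m)) (alpha (fatIdeal p m) - 1)

/-- A minimal graded free resolution `0 → F₁ → F₀ → I → 0` of an ideal, with
`F₀ = ⨁ i, R[-a i]` of rank `r` and `F₁ = ⨁ j, R[-b j]` of rank `s`. The map `F₀ → I` sends the
`i`-th basis vector to `g i`, and `φ` is the matrix of `F₁ → F₀`. -/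
structure IsMinimalFreeResolution (I : Ideal (Ring3 k)) {r s : ℕ} (a : Fin r → ℕ) (b : Fin s → ℕ)
    (g : Fin r → Ring3 k) (φ : Matrix (Fin r) (Fin s) (Ring3 k)) : Prop where
  /-- `F₀ → I` preserves degrees. -/
  homogeneous_g : ∀ i, (g i).IsHomogeneous (a i)
  /-- `F₁ → F₀` preserves degrees: entry `(i, j)` is a form of degree `b j - a i`, which is zero if
  this number is negative. -/
  homogeneous_φ : ∀ i j, (a i ≤ b j → (φ i j).IsHomogeneous (b j - a i)) ∧ (b j < a i → φ i j = 0)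
  /-- `F₀ → I` is surjective. -/
  surjective : LinearMap.range (Fintype.linearCombination (Ring3 k) g) = I
  /-- Exactness at `F₀`. -/
  exact : LinearMap.range φ.mulVecLin = LinearMap.ker (Fintype.linearCombination (Ring3 k) g)
  /-- `F₁ → F₀` is injective. -/
  injective : Function.Injective φ.mulVecLin
  /-- Minimality: `F₁` is mapped into `(x, y, z) F₀`. -/
  minimal : ∀ i j, MvPolynomial.constantCoeff (φ i j) = 0

/-- The ideal `I` of `m₁ p₁ + ⋯ + mₙ pₙ` is unhindered and the rank of `F₀` in its minimal free
resolution `0 → F₁ → F₀ → I → 0` (which is unique up to isomorphism) is `max {h, α + 2 - h}`,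
where `α` is the least degree with `I_α ≠ 0` and `h = dim_k I_α`. -/
def RankMinimal {n : ℕ} (p : Fin n → Plane k) (m : Fin n → ℕ) : Prop :=
  Unhindered p m ∧
    ∃ (r s : ℕ) (a : Fin r → ℕ) (b : Fin s → ℕ) (g : Fin r → Ring3 k)
      (φ : Matrix (Fin r) (Fin s) (Ring3 k)),
      IsMinimalFreeResolution (fatIdeal p m) a b g φ ∧
      (r : ℤ) = max (hilb (fatIdeal p m) (alpha (fatIdeal p m)) : ℤ)
        ((alpha (fatIdeal p m) : ℤ) + 2 - (hilb (fatIdeal p m) (alpha (fatIdeal p m)) : ℤ))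

/-- Zariski open subsets of `(ℙ²)ⁿ`: complements of the common zero locus of a set of
multihomogeneous polynomials, that is, polynomials in the coordinates `x_{i,j}` (`j`-th coordinate
of the `i`-th point) that are homogeneous, of some degree `d i`, in the coordinates of the `i`-th
point, for each `i`. -/
def IsZariskiOpen {n : ℕ} (U : Set (Fin n → Plane k)) : Prop :=
  ∃ S : Set (MvPolynomial (Fin n × Fin 3) k),
    (∀ F ∈ S, ∃ d : Fin n → ℕ,
      F.IsWeightedHomogeneous (fun v : Fin n × Fin 3 => (Pi.single v.1 1 : Fin n → ℕ)) d) ∧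
    U = {p | ∃ F ∈ S, MvPolynomial.eval (fun v : Fin n × Fin 3 => (p v.1).rep v.2) F ≠ 0}

/-- `P` holds for `n` general points of the plane: it holds for all `n`-tuples of points in some
nonempty Zariski open subset of `(ℙ²)ⁿ`. -/
def ForGeneralPoints {n : ℕ} (P : (Fin n → Plane k) → Prop) : Prop :=
  ∃ U : Set (Fin n → Plane k), IsZariskiOpen U ∧ U.Nonempty ∧ ∀ p ∈ U, P p

end FatPoints

/-! Ideals of fat points in the plane whose Hilbert function is the expected one, and the maximal
rank of the multiplication by linear forms in their initial degree. -/

namespace FatPoints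

universe u

variable {k : Type u} [Field k]

open MvPolynomial

/-! Let `μ : R_1 ⊗ I_α → I_{α+1}` be multiplication (`mulMap`). If `I` is unhindered, then `h_I(t+1)
= h_I(t) + t + 2` for `t ≥ α`, and a Castelnuovo–Mumford argument with a line missing the points
shows that `I` is generated in degrees `α` and `α + 1`. So `F_0` has rank `h + dim coker μ`. Since
`h_I(α+1) = h + α + 2`, this equals `max {h, α + 2 - h}` as soon as `μ` has maximal rank
(`Unhindered.rankMinimal`).

An element of `ker μ` is a triple `f` in `I_α` with `∑ X_i f_i = 0`. Let `v` represent the first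
point (index `0`). Then `∑ v_i f_i` lies in `I'_α`, because `X_j ∑ v_i f_i = ∑ (v_i X_j - v_j X_i)
f_i` gains one order of vanishing at `v`. If it is zero, `f` is orthogonal to both `X` and `v`, so
`f = (X × v) e` with `e` in `I''_{α-1}`. Hence `dim ker μ ≤ q + l` (`finrank_ker_mulMap_le`), which
gives (a).

In (b), semicontinuity and `m_1 = m_2` make the evaluation at the second point vanish too. Then `e`
times the equation of the line through the two points is zero, so `μ` is injective
(`ker_mulMap_eq_bot_of_swap`). In (c), the case `q = 0` is (b); otherwise the expected dimensions
give `q + l = 2h - (α + 2)`, so `μ` has rank at least `h + α + 2` and is onto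
(`le_finrank_range_mulMap`).

The resolution itself exists because `I` is saturated: `X_0, X_1, X_2` is then a regular sequence on
the syzygy module, and minimal homogeneous generators of that module are a basis
(`linearIndependent_of_saturated`). Generality of the points is used only for the first point being
distinct from the others, and for the semicontinuity in (b). -/

/-! ### Order of vanishing at a point and membership in fat point ideals. -/

theorem aeval_mul_of_isHomogeneous {σ A R : Type*} [CommSemiring A] [CommSemiring R] [Algebra A R]
    {f : MvPolynomial σ A} {d : ℕ} (hf : f.IsHomogeneous d) (c : R) (w : σ → R) :
    aeval (fun i => c * w i) f = c ^ d * aeval w f := by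
  rw [aeval_def, aeval_def, eval₂_eq, eval₂_eq, Finset.mul_sum]
  refine Finset.sum_congr rfl fun b hb => ?_
  have h : b.degree = d := by
    have := hf (mem_support_iff.mp hb)
    rwa [Finsupp.degree_eq_weight_one]
  simp only [mul_pow, Finset.prod_mul_distrib, Finset.prod_pow_eq_pow_sum]
  rw [← h, Finsupp.degree_apply]
  ring

/-- The expansion of a polynomial around the points of the line spanned by `v`. -/
noncomputable def taylorAt (v : Fin 3 → k) : Ring3 k →ₐ[k] MvPolynomial (Fin 3) (Polynomial k) :=
  aeval fun i => C (Polynomial.X * Polynomial.C (v i)) + X i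

/-- The order of vanishing of a polynomial along the line spanned by `v`. -/
noncomputable def ord (v : Fin 3 → k) (f : Ring3 k) : ℕ∞ :=
  (taylorAt v f : MvPowerSeries (Fin 3) (Polynomial k)).order

/-- The coefficients lie in the domain `k[T]`, so lowest-order forms multiply without cancellation.
-/
theorem ord_mul (v : Fin 3 → k) (f g : Ring3 k) : ord v (f * g) = ord v f + ord v g := by
  simp [ord, MvPowerSeries.order_mul]

theorem le_ord_iff_coeff (v : Fin 3 → k) (f : Ring3 k) (m : ℕ) :
    (m : ℕ∞) ≤ ord v f ↔ ∀ b : Fin 3 →₀ ℕ, b.degree < m → coeff b (taylorAt v f) = 0 := by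
  refine ⟨fun h b hb => ?_, fun h => ?_⟩
  · rw [← MvPolynomial.coeff_coe]
    exact MvPowerSeries.coeff_of_lt_order (lt_of_lt_of_le (by exact_mod_cast hb) h)
  · refine MvPowerSeries.le_order fun b hb => ?_
    rw [MvPolynomial.coeff_coe]
    exact h b (by exact_mod_cast hb)

theorem le_ord_iff_mem (v : Fin 3 → k) (f : Ring3 k) (m : ℕ) :
    (m : ℕ∞) ≤ ord v f ↔ taylorAt v f ∈ idealOfVars (Fin 3) (Polynomial k) ^ m := by
  rw [le_ord_iff_coeff, mem_pow_idealOfVars_iff']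

theorem constantCoeff_taylorAt (v : Fin 3 → k) {f : Ring3 k} {d : ℕ} (hf : f.IsHomogeneous d) :
    constantCoeff (taylorAt v f) = Polynomial.X ^ d * Polynomial.C (eval v f) := by
  have h1 : (constantCoeff.comp (taylorAt v).toRingHom : Ring3 k →+* Polynomial k) =
      (aeval fun i => (Polynomial.X : Polynomial k) * Polynomial.C (v i)).toRingHom := by
    refine MvPolynomial.ringHom_ext (fun r => ?_) fun i => ?_ <;>
      simp [taylorAt, MvPolynomial.algebraMap_apply]
  have h2 : (aeval fun i => Polynomial.C (v i)).toRingHom = Polynomial.C.comp (eval v) := by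
    refine MvPolynomial.ringHom_ext (fun r => ?_) fun i => ?_ <;> simp
  have h1 : constantCoeff (taylorAt v f) =
      aeval (fun i => (Polynomial.X : Polynomial k) * Polynomial.C (v i)) f :=
    DFunLike.congr_fun h1 f
  have h2 : aeval (fun i => Polynomial.C (v i)) f = Polynomial.C (eval v f) :=
    DFunLike.congr_fun h2 f
  rw [h1, aeval_mul_of_isHomogeneous hf, h2]

theorem pointIdeal_le_comap (p : Plane k) :
    pointIdeal p ≤ (idealOfVars (Fin 3) (Polynomial k)).comap (taylorAt p.rep) := by
  rw [pointIdeal, Ideal.span_le]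
  rintro f ⟨d, hf, h0⟩
  have := (mem_pow_idealOfVars_iff' 1 (taylorAt p.rep f)).mpr (fun b hb => by
    have hb : b = 0 := by simpa [Finsupp.degree_eq_zero_iff] using hb
    subst hb
    have := constantCoeff_taylorAt p.rep hf
    rw [h0] at this
    simpa [constantCoeff_eq] using this)
  simpa using this

/-- The left inverse of `taylorAt v` that sends the ideal of the variables to the point ideal. -/
noncomputable def retraction (v : Fin 3 → k) (j : Fin 3) :
    MvPolynomial (Fin 3) (Polynomial k) →+* Ring3 k :=
  -- The parameter of the line becomes `X_j / v_j`, giving the multiple of `v` that agrees with `X`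
  -- in coordinate `j`.
  eval₂Hom (Polynomial.aeval (C (v j)⁻¹ * X j : Ring3 k)).toRingHom
    fun i => X i - C (v i) * (C (v j)⁻¹ * X j)

theorem retraction_taylorAt (v : Fin 3 → k) (j : Fin 3) (f : Ring3 k) :
    retraction v j (taylorAt v f) = f := by
  have : (retraction v j).comp (taylorAt v).toRingHom = RingHom.id _ := by
    refine MvPolynomial.ringHom_ext (fun r => ?_) fun i => ?_
    · simp [retraction, taylorAt, MvPolynomial.algebraMap_apply]
    · simp [retraction, taylorAt]
  exact DFunLike.congr_fun this f

theorem map_retraction_le (p : Plane k) {j : Fin 3} (hj : p.rep j ≠ 0) :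
    (idealOfVars (Fin 3) (Polynomial k)).map (retraction p.rep j) ≤ pointIdeal p := by
  rw [idealOfVars, Ideal.map_span, Ideal.span_le]
  rintro _ ⟨_, ⟨i, rfl⟩, rfl⟩
  refine Ideal.subset_span ⟨1, ?_, ?_⟩
  · simp only [retraction, coe_eval₂Hom, eval₂_X, ← mul_assoc, ← C_mul]
    exact (isHomogeneous_X _ _).sub (isHomogeneous_C_mul_X _ _)
  · simp [retraction, hj]

/-- `taylorAt` carries the point ideal into the ideal of the variables and `retraction` carries the
latter back, so the same holds for powers. Membership in a power thereby becomes a condition on the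
additive function `ord`. -/
theorem mem_pointIdeal_pow_iff (p : Plane k) (m : ℕ) (f : Ring3 k) :
    f ∈ pointIdeal p ^ m ↔ (m : ℕ∞) ≤ ord p.rep f := by
  rw [le_ord_iff_mem]
  constructor
  · intro h
    have := Ideal.mem_map_of_mem (taylorAt p.rep) h
    rw [Ideal.map_pow] at this
    exact Ideal.pow_right_mono (Ideal.map_le_iff_le_comap.mpr (pointIdeal_le_comap p)) _ this
  · intro h
    obtain ⟨j, hj⟩ := Function.ne_iff.mp p.rep_nonzero
    have := Ideal.mem_map_of_mem (retraction p.rep j) h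
    rw [Ideal.map_pow, retraction_taylorAt] at this
    exact Ideal.pow_right_mono (map_retraction_le p hj) _ this

theorem mem_fatIdeal_iff {n : ℕ} (p : Fin n → Plane k) (m : Fin n → ℕ) (f : Ring3 k) :
    f ∈ fatIdeal p m ↔ ∀ i, (m i : ℕ∞) ≤ ord (p i).rep f := by
  simp [fatIdeal, mem_pointIdeal_pow_iff]

/-- The linear form with coefficient vector `a`. -/
noncomputable def linForm (a : Fin 3 → k) : Ring3 k := ∑ i, C (a i) * X i

theorem isHomogeneous_linForm (a : Fin 3 → k) : (linForm a).IsHomogeneous 1 :=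
  IsHomogeneous.sum _ _ _ fun _ _ => isHomogeneous_C_mul_X _ _

theorem eval_linForm (a v : Fin 3 → k) : eval v (linForm a) = a ⬝ᵥ v := by
  simp [linForm, dotProduct]

theorem coeff_linForm (a : Fin 3 → k) (j : Fin 3) :
    coeff (Finsupp.single j 1) (linForm a) = a j := by
  simp [linForm, coeff_sum, coeff_C_mul, coeff_X, Finsupp.single_left_inj]

theorem linForm_ne_zero {a : Fin 3 → k} (ha : a ≠ 0) : linForm a ≠ 0 := by
  obtain ⟨j, hj⟩ := Function.ne_iff.mp ha
  intro h
  have := coeff_linForm a j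
  rw [h] at this
  exact hj (by simpa using this.symm)

theorem ord_linForm_of_ne {a v : Fin 3 → k} (h : a ⬝ᵥ v ≠ 0) : ord v (linForm a) = 0 := by
  by_contra h0
  have h1 : ((1 : ℕ) : ℕ∞) ≤ ord v (linForm a) := by
    simpa [Order.one_le_iff_ne_zero] using h0
  have h2 := (le_ord_iff_coeff _ _ _).mp h1 0 (by simp)
  have h3 := constantCoeff_taylorAt v (isHomogeneous_linForm a)
  rw [constantCoeff_eq, h2, eval_linForm] at h3
  simp [h] at h3

theorem ord_linForm_le {a : Fin 3 → k} (v : Fin 3 → k) (ha : a ≠ 0) : ord v (linForm a) ≤ 1 := by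
  obtain ⟨j, hj⟩ := Function.ne_iff.mp ha
  by_contra h0
  have h1 : ((2 : ℕ) : ℕ∞) ≤ ord v (linForm a) := by
    have := not_le.mp h0
    exact_mod_cast Order.add_one_le_of_lt this
  have h2 := (le_ord_iff_coeff _ _ _).mp h1 (Finsupp.single j 1) (by simp)
  have h3 : coeff (Finsupp.single j 1) (taylorAt v (linForm a)) = Polynomial.C (a j) := by
    simp only [linForm, taylorAt, map_sum, map_mul, aeval_X, coeff_sum, algHom_C]
    simp [MvPolynomial.algebraMap_apply, coeff_C_mul, coeff_X, Finsupp.single_left_inj, coeff_C,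
      (Finsupp.single_ne_zero.mpr one_ne_zero).symm]
  rw [h3] at h2
  exact hj (by simpa using h2)

theorem one_le_ord_linForm {a v : Fin 3 → k} (h : a ⬝ᵥ v = 0) : 1 ≤ ord v (linForm a) := by
  refine (le_ord_iff_coeff v (linForm a) 1).mpr fun b hb => ?_
  have hb : b = 0 := by simpa [Finsupp.degree_eq_zero_iff] using hb
  subst hb
  rw [← constantCoeff_eq, constantCoeff_taylorAt v (isHomogeneous_linForm a), eval_linForm, h]
  simp

attribute [local instance] MvPolynomial.gradedAlgebra

theorem isHomogeneous_pow {I : Ideal (Ring3 k)}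
    (hI : I.IsHomogeneous (homogeneousSubmodule (Fin 3) k)) (m : ℕ) :
    (I ^ m).IsHomogeneous (homogeneousSubmodule (Fin 3) k) := by
  induction m with
  | zero => simpa using Ideal.IsHomogeneous.top _
  | succ m ih => rw [pow_succ]; exact ih.mul hI

theorem homogeneousComponent_mem_fatIdeal {n : ℕ} (p : Fin n → Plane k) (m : Fin n → ℕ)
    {f : Ring3 k} (hf : f ∈ fatIdeal p m) (t : ℕ) : homogeneousComponent t f ∈ fatIdeal p m := by
  refine homogeneousComponent_mem_of_mem ?_ hf t
  refine Ideal.IsHomogeneous.iInf fun i => isHomogeneous_pow ?_ _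
  exact Ideal.homogeneous_span _ _ fun f ⟨d, hd, _⟩ => ⟨d, hd⟩

/-! ### Lifting independence along a regular element. -/

section Descent

variable {σ : Type*} {M : Type*} [AddCommGroup M] [Module (MvPolynomial σ k) M]

/-- Monomials are sorted by divisibility by `X i`. The drop in degree is what makes the next
induction terminate. -/
theorem exists_add_X_mul_of_mem {T : Set σ} {i : σ} {c : MvPolynomial σ k}
    (hc : c ∈ Ideal.span ((X : σ → MvPolynomial σ k) '' insert i T)) :
    ∃ a ∈ Ideal.span ((X : σ → MvPolynomial σ k) '' T), ∃ c' : MvPolynomial σ k,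
      c = a + X i * c' ∧ (c' = 0 ∨ c'.totalDegree < c.totalDegree) := by
  classical
  refine ⟨c.modMonomial (Finsupp.single i 1), ?_, c.divMonomial (Finsupp.single i 1), ?_, ?_⟩
  · rw [mem_ideal_span_X_image] at hc ⊢
    intro b hb
    have hle : ¬ Finsupp.single i 1 ≤ b := fun hle =>
      (mem_support_iff.mp hb) (coeff_modMonomial_of_le _ hle)
    have hb' : b ∈ c.support := by
      rw [mem_support_iff, coeff_modMonomial_of_not_le _ hle] at hb
      exact mem_support_iff.mpr hb
    obtain ⟨j, hj, hbj⟩ := hc b hb'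
    rcases hj with rfl | hj
    · exact absurd (Finsupp.single_le_iff.mpr (Nat.one_le_iff_ne_zero.mpr hbj)) hle
    · exact ⟨j, hj, hbj⟩
  · rw [add_comm, divMonomial_add_modMonomial_single]
  · by_cases h0 : c.divMonomial (Finsupp.single i 1) = 0
    · exact Or.inl h0
    · right
      obtain ⟨b, hb, hd⟩ := Finset.exists_mem_eq_sup _ (support_nonempty.mpr h0)
        fun s : σ →₀ ℕ => s.sum fun _ e => e
      have hb' : Finsupp.single i 1 + b ∈ c.support := by
        rw [mem_support_iff, coeff_divMonomial] at hb
        exact mem_support_iff.mpr hb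
      have := le_totalDegree hb'
      rw [Finsupp.sum_add_index' (fun _ => rfl) (fun _ _ _ => rfl),
        Finsupp.sum_single_index rfl] at this
      rw [totalDegree, hd]
      omega

/-- Coefficients of a relation modulo `T` lie in the larger ideal, so each is `a + X i * c'` with
`a` in the smaller one. Regularity cancels `X i`, leaving a relation modulo `T` among the `c'`,
which have smaller degree. -/
theorem mem_span_X_of_sum_smul_mem {κ : Type*} [Fintype κ] {w : κ → M} {T : Set σ} {i : σ}
    (hreg : ∀ x : M,
      (X i : MvPolynomial σ k) • x ∈ Ideal.span ((X : σ → MvPolynomial σ k) '' T) •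
        (⊤ : Submodule (MvPolynomial σ k) M) →
        x ∈ Ideal.span ((X : σ → MvPolynomial σ k) '' T) •
        (⊤ : Submodule (MvPolynomial σ k) M))
    (hind : ∀ c : κ → MvPolynomial σ k,
      ∑ j, c j • w j ∈ Ideal.span ((X : σ → MvPolynomial σ k) '' insert i T) •
        (⊤ : Submodule (MvPolynomial σ k) M) →
        ∀ j, c j ∈ Ideal.span ((X : σ → MvPolynomial σ k) '' insert i T))
    (c : κ → MvPolynomial σ k)
    (hc : ∑ j, c j • w j ∈ Ideal.span ((X : σ → MvPolynomial σ k) '' T) •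
        (⊤ : Submodule (MvPolynomial σ k) M)) :
    ∀ j, c j ∈ Ideal.span ((X : σ → MvPolynomial σ k) '' T) := by
  have key : ∀ (N : ℕ) (c : κ → MvPolynomial σ k), (∀ j, c j = 0 ∨ (c j).totalDegree < N) →
      ∑ j, c j • w j ∈ Ideal.span ((X : σ → MvPolynomial σ k) '' T) •
        (⊤ : Submodule (MvPolynomial σ k) M) →
        ∀ j, c j ∈ Ideal.span ((X : σ → MvPolynomial σ k) '' T) := by
    intro N
    induction N with
    | zero => exact fun c h _ j => by simp [(h j).resolve_right (Nat.not_lt_zero _)]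
    | succ N ih =>
      intro c hN hc
      have hle : Ideal.span ((X : σ → MvPolynomial σ k) '' T) ≤
          Ideal.span ((X : σ → MvPolynomial σ k) '' insert i T) :=
        Ideal.span_mono (Set.image_mono (Set.subset_insert _ _))
      have h1 := hind c (Submodule.smul_mono_left hle hc)
      choose a ha c' hcc' hdeg using fun j => exists_add_X_mul_of_mem (h1 j)
      have h2 : (X i : MvPolynomial σ k) • ∑ j, c' j • w j
          ∈ Ideal.span ((X : σ → MvPolynomial σ k) '' T) •
        (⊤ : Submodule (MvPolynomial σ k) M) := by
        have : (X i : MvPolynomial σ k) • ∑ j, c' j • w j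
            = ∑ j, c j • w j - ∑ j, a j • w j := by
          rw [Finset.smul_sum, ← Finset.sum_sub_distrib]
          refine Finset.sum_congr rfl fun j _ => ?_
          rw [← sub_smul, smul_smul]
          congr 1
          rw [hcc' j]
          ring
        rw [this]
        exact Submodule.sub_mem _ hc
          (Submodule.sum_mem _ fun j _ => Submodule.smul_mem_smul (ha j) trivial)
      have h3 := ih c' (fun j => (hdeg j).imp_right fun h => by
        rcases hN j with h0 | h0
        · rw [h0] at h; simp at h
        · omega) (hreg _ h2)
      intro j
      rw [hcc' j]
      exact Ideal.add_mem _ (ha j) (Ideal.mul_mem_left _ _ (h3 j))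
  refine key (∑ j, ((c j).totalDegree + 1)) c (fun j => Or.inr ?_) hc
  exact lt_of_lt_of_le (Nat.lt_succ_self _)
    (Finset.single_le_sum (f := fun j => (c j).totalDegree + 1) (fun _ _ => Nat.zero_le _)
      (Finset.mem_univ j))

end Descent

/-! ### The variables as a regular sequence on a syzygy module. -/

section Syzygies

variable {ι : Type*}

theorem mem_span_X_of_X_mul_mem {σ : Type*} {T : Set σ} {i : σ} (hi : i ∉ T) {v : MvPolynomial σ k}
    (h : X i * v ∈ Ideal.span ((X : σ → MvPolynomial σ k) '' T)) :
    v ∈ Ideal.span ((X : σ → MvPolynomial σ k) '' T) := by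
  rw [mem_ideal_span_X_image] at h ⊢
  intro b hb
  obtain ⟨j, hj, hbj⟩ := h (Finsupp.single i 1 + b) (by
    rw [mem_support_iff, coeff_X_mul]
    exact mem_support_iff.mp hb)
  refine ⟨j, hj, ?_⟩
  have : i ≠ j := fun h => hi (h ▸ hj)
  simpa [Finsupp.single_eq_of_ne this.symm] using hbj

theorem X_dvd_of_X_dvd_X_mul {σ : Type*} {i j : σ} (hij : i ≠ j) {v : MvPolynomial σ k}
    (h : X i ∣ X j * v) : X i ∣ v := by
  have := mem_span_X_of_X_mul_mem (T := {i}) (i := j) (v := v) (by simpa using hij.symm)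
  simp only [Set.image_singleton, Ideal.mem_span_singleton] at this
  exact this h

/-- Exactness of the Koszul complex of the three variables: a linear relation among them is a
combination of the three trivial ones. -/
theorem exists_koszul {u v w : Ring3 k} (h : X 2 * w = X 0 * u + X 1 * v) :
    ∃ u' v' c, w = X 0 * u' + X 1 * v' ∧ u = X 2 * u' + X 1 * c ∧ v = X 2 * v' - X 0 * c := by
  have hv : v ∈ Ideal.span ((X : Fin 3 → Ring3 k) '' {0, 2}) := by
    refine mem_span_X_of_X_mul_mem (i := 1) (by simp) ?_
    have : X 1 * v = X 2 * w - X 0 * u := by rw [h]; ring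
    rw [this]
    exact Ideal.sub_mem _ (Ideal.mul_mem_right _ _ (Ideal.subset_span ⟨2, by simp, rfl⟩))
      (Ideal.mul_mem_right _ _ (Ideal.subset_span ⟨0, by simp, rfl⟩))
  rw [Set.image_pair, Ideal.mem_span_pair] at hv
  obtain ⟨v0, v', hv⟩ := hv
  have h1 : X 2 * (w - X 1 * v') = X 0 * (u + X 1 * v0) := by
    rw [mul_sub, h, ← hv]; ring
  obtain ⟨u', hu'⟩ := X_dvd_of_X_dvd_X_mul (i := (0 : Fin 3)) (j := 2) (by decide) ⟨_, h1⟩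
  rw [hu'] at h1
  have h2 : u + X 1 * v0 = X 2 * u' := by
    refine mul_left_cancel₀ (X_ne_zero (0 : Fin 3)) ?_
    rw [← h1]; ring
  refine ⟨u', v', -v0, ?_, ?_, ?_⟩
  · rw [← hu']; ring
  · rw [← h2]; ring
  · rw [← hv]; ring

theorem regular_zero (K : Submodule (Ring3 k) (ι → Ring3 k)) (x : K)
    (hx : (X 0 : Ring3 k) • x ∈
      Ideal.span ((X : Fin 3 → Ring3 k) '' ∅) • (⊤ : Submodule (Ring3 k) K)) :
    x ∈ Ideal.span ((X : Fin 3 → Ring3 k) '' ∅) • (⊤ : Submodule (Ring3 k) K) := by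
  simp only [Set.image_empty, Ideal.span_empty, Submodule.bot_smul, Submodule.mem_bot] at hx ⊢
  exact (smul_eq_zero.mp hx).resolve_left (X_ne_zero _)

theorem mem_span_X_zero_smul_iff {M : Type*} [AddCommGroup M] [Module (Ring3 k) M] (x : M) :
    x ∈ Ideal.span ((X : Fin 3 → Ring3 k) '' insert 0 ∅) • (⊤ : Submodule (Ring3 k) M) ↔
      ∃ y, x = (X 0 : Ring3 k) • y := by
  simp [Submodule.ideal_span_singleton_smul, Submodule.mem_smul_pointwise_iff_exists, eq_comm]

theorem mem_span_X_one_smul_iff {M : Type*} [AddCommGroup M] [Module (Ring3 k) M] (x : M) :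
    x ∈ Ideal.span ((X : Fin 3 → Ring3 k) '' insert 1 (insert 0 ∅)) •
        (⊤ : Submodule (Ring3 k) M) ↔
      ∃ y z, x = (X 0 : Ring3 k) • y + (X 1 : Ring3 k) • z := by
  rw [Set.image_insert_eq, Ideal.span_insert, Submodule.sup_smul, Submodule.mem_sup]
  simp only [mem_span_X_zero_smul_iff, Submodule.ideal_span_singleton_smul,
    Submodule.mem_smul_pointwise_iff_exists]
  constructor
  · rintro ⟨_, ⟨z, _, rfl⟩, _, ⟨y, rfl⟩, rfl⟩
    exact ⟨y, z, add_comm _ _⟩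
  · rintro ⟨y, z, rfl⟩
    exact ⟨_, ⟨z, trivial, rfl⟩, _, ⟨y, rfl⟩, add_comm _ _⟩

/-- The free module modulo the kernel embeds in the torsion-free module `Ring3 k`, so a syzygy
divisible by `X 0` is `X 0` times a syzygy. -/
theorem regular_one (G : (ι → Ring3 k) →ₗ[Ring3 k] Ring3 k) (x : LinearMap.ker G)
    (hx : (X 1 : Ring3 k) • x ∈ Ideal.span ((X : Fin 3 → Ring3 k) '' insert 0 ∅) •
      (⊤ : Submodule (Ring3 k) (LinearMap.ker G))) :
    x ∈ Ideal.span ((X : Fin 3 → Ring3 k) '' insert 0 ∅) •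
      (⊤ : Submodule (Ring3 k) (LinearMap.ker G)) := by
  rw [mem_span_X_zero_smul_iff] at hx ⊢
  obtain ⟨y, hy⟩ := hx
  have h : ∀ i, X 1 * x.1 i = X 0 * y.1 i := fun i =>
    congrFun (congrArg Subtype.val hy) i
  choose z hz using fun i =>
    X_dvd_of_X_dvd_X_mul (i := (0 : Fin 3)) (j := 1) (by decide) ⟨_, h i⟩
  have hz' : x.1 = (X 0 : Ring3 k) • z := funext hz
  refine ⟨⟨z, ?_⟩, Subtype.ext hz'⟩
  have h0 := x.2
  rw [hz', LinearMap.mem_ker, map_smul] at h0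
  exact (smul_eq_zero.mp h0).resolve_left (X_ne_zero _)

/-- The Koszul coefficients `u, v, c` need not be syzygies, but `G` sends them to `X 1 * e`, `-X 0 *
e`, `-X 2 * e` for one `e`. Saturation gives `e = G e'`, and correcting `u` and `v` by multiples of
`e'` makes them syzygies without changing `X 0 * u + X 1 * v`. -/
theorem regular_two (G : (ι → Ring3 k) →ₗ[Ring3 k] Ring3 k)
    (hsat : ∀ e, (∀ i, X i * e ∈ LinearMap.range G) →
      e ∈ LinearMap.range G)
    (x : LinearMap.ker G)
    (hx : (X 2 : Ring3 k) • x ∈ Ideal.span ((X : Fin 3 → Ring3 k) '' insert 1 (insert 0 ∅)) •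
      (⊤ : Submodule (Ring3 k) (LinearMap.ker G))) :
    x ∈ Ideal.span ((X : Fin 3 → Ring3 k) '' insert 1 (insert 0 ∅)) •
      (⊤ : Submodule (Ring3 k) (LinearMap.ker G)) := by
  rw [mem_span_X_one_smul_iff] at hx ⊢
  obtain ⟨y, z, hyz⟩ := hx
  have h : ∀ i, X 2 * x.1 i = X 0 * y.1 i + X 1 * z.1 i := fun i =>
    congrFun (congrArg Subtype.val hyz) i
  choose u v c hw hu hv using fun i => exists_koszul (h i)
  have hw' : x.1 = (X 0 : Ring3 k) • u + (X 1 : Ring3 k) • v := funext hw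
  have hu' : y.1 = (X 2 : Ring3 k) • u + (X 1 : Ring3 k) • c := funext hu
  have h1 : X 0 * G u + X 1 * G v = 0 := by
    have := x.2
    rwa [hw', LinearMap.mem_ker, map_add, map_smul, map_smul] at this
  have h2 : X 2 * G u + X 1 * G c = 0 := by
    have := y.2
    rwa [hu', LinearMap.mem_ker, map_add, map_smul, map_smul] at this
  obtain ⟨e, he⟩ := X_dvd_of_X_dvd_X_mul (i := (1 : Fin 3)) (j := 0) (v := G u) (by decide)
    ⟨-G v, by linear_combination h1⟩
  have hGv : G v = -(X 0 * e) := by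
    refine mul_left_cancel₀ (X_ne_zero (1 : Fin 3)) ?_
    rw [he] at h1
    linear_combination h1
  have hGc : G c = -(X 2 * e) := by
    refine mul_left_cancel₀ (X_ne_zero (1 : Fin 3)) ?_
    rw [he] at h2
    linear_combination h2
  obtain ⟨e', he'⟩ := hsat e (fun i => by
    fin_cases i
    · exact ⟨-v, by simp [hGv]⟩
    · exact ⟨u, by simp [he]⟩
    · exact ⟨-c, by simp [hGc]⟩)
  refine ⟨⟨u - (X 1 : Ring3 k) • e', ?_⟩, ⟨v + (X 0 : Ring3 k) • e', ?_⟩, Subtype.ext ?_⟩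
  · rw [LinearMap.mem_ker, map_sub, map_smul, he, he', smul_eq_mul, sub_self]
  · rw [LinearMap.mem_ker, map_add, map_smul, hGv, he', smul_eq_mul, neg_add_cancel]
  · simp only [Submodule.coe_add, Submodule.coe_smul]
    rw [hw', smul_sub, smul_add, smul_comm (X 0 : Ring3 k) (X 1 : Ring3 k) e']
    abel

/-- Elements of the kernel that are independent modulo the homogeneous maximal ideal are
independent. -/
theorem linearIndependent_of_saturated {κ : Type*} [Fintype κ]
    (G : (ι → Ring3 k) →ₗ[Ring3 k] Ring3 k)
    (hsat : ∀ e, (∀ i, X i * e ∈ LinearMap.range G) →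
      e ∈ LinearMap.range G)
    (w : κ → LinearMap.ker G)
    (hw : ∀ c : κ → Ring3 k, ∑ j, c j • w j ∈ idealOfVars (Fin 3) k • (⊤ : Submodule (Ring3 k) _) →
      ∀ j, c j ∈ idealOfVars (Fin 3) k)
    (c : κ → Ring3 k) (hc : ∑ j, c j • w j = 0) : c = 0 := by
  have huniv : insert (2 : Fin 3) (insert 1 (insert 0 ∅)) = (Set.univ : Set (Fin 3)) := by
    ext i; fin_cases i <;> simp
  -- Independence descends from `(X 0, X 1, X 2)` through `(X 0, X 1)` and `(X 0)` to the zero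
  -- ideal.
  have h := mem_span_X_of_sum_smul_mem (regular_zero _)
    (mem_span_X_of_sum_smul_mem (regular_one G)
      (mem_span_X_of_sum_smul_mem (regular_two G hsat) (w := w) (by
        rw [huniv, Set.image_univ]; exact hw))) c (by rw [hc]; exact Submodule.zero_mem _)
  funext j
  simpa using h j

end Syzygies

/-! ### Graded submodules of free modules and minimal homogeneous generators. -/

section Graded

variable {σ : Type*}

/-- The homogeneous component of degree `t - a`, which is zero if `t < a`. -/
noncomputable def shiftComponent (t a : ℕ) : MvPolynomial σ k →ₗ[k] MvPolynomial σ k :=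
  if a ≤ t then homogeneousComponent (t - a) else 0

theorem shiftComponent_of_le {t a : ℕ} (h : a ≤ t) (f : MvPolynomial σ k) :
    shiftComponent t a f = homogeneousComponent (t - a) f := by
  simp [shiftComponent, h]

theorem shiftComponent_of_lt {t a : ℕ} (h : t < a) (f : MvPolynomial σ k) :
    shiftComponent t a f = 0 := by
  simp [shiftComponent, not_le.mpr h]

theorem shiftComponent_self (t : ℕ) (f : MvPolynomial σ k) :
    shiftComponent t t f = C (constantCoeff f) := by
  simp [shiftComponent, constantCoeff_eq]

theorem homogeneousComponent_mul_of_isHomogeneous {g : MvPolynomial σ k} {a : ℕ}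
    (hg : g.IsHomogeneous a) (t : ℕ) (f : MvPolynomial σ k) :
    homogeneousComponent t (f * g) = shiftComponent t a f * g := by
  have h : ∀ i, homogeneousComponent t (homogeneousComponent i f * g) =
      if i + a = t then homogeneousComponent i f * g else 0 := fun i => by
    have := homogeneousComponent_of_mem (m := t) ((homogeneousComponent_isHomogeneous i f).mul hg)
    rw [this]
    simp only [eq_comm]
  conv_lhs => rw [← sum_homogeneousComponent f, Finset.sum_mul, map_sum]
  simp only [h]
  by_cases ha : a ≤ t
  · rw [shiftComponent_of_le ha]
    by_cases hd : t - a ≤ f.totalDegree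
    · rw [Finset.sum_eq_single (t - a)]
      · simp [ha]
      · intro i _ hi
        rw [if_neg (by omega)]
      · intro hi
        exact absurd (Finset.mem_range.mpr (by omega)) hi
    · rw [homogeneousComponent_eq_zero _ _ (by omega), zero_mul]
      refine Finset.sum_eq_zero fun i hi => ?_
      rw [if_neg (by have := Finset.mem_range.mp hi; omega)]
  · rw [shiftComponent_of_lt (by omega), zero_mul]
    exact Finset.sum_eq_zero fun i _ => by rw [if_neg (by omega)]

variable {ι : Type*}

/-- `v` is homogeneous of degree `t` as an element of the free module whose basis vectors have the
degrees `a i`. -/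
def IsHomogeneousVec (a : ι → ℕ) (t : ℕ) (v : ι → MvPolynomial σ k) : Prop :=
  ∀ i, (a i ≤ t → (v i).IsHomogeneous (t - a i)) ∧ (t < a i → v i = 0)

/-- The component of degree `t` in the free module whose basis vectors have the degrees `a i`. -/
noncomputable def vecComponent (a : ι → ℕ) (t : ℕ) :
    (ι → MvPolynomial σ k) →ₗ[k] (ι → MvPolynomial σ k) :=
  LinearMap.pi fun i => shiftComponent t (a i) ∘ₗ LinearMap.proj i

theorem vecComponent_apply (a : ι → ℕ) (t : ℕ) (v : ι → MvPolynomial σ k) (i : ι) :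
    vecComponent a t v i = shiftComponent t (a i) (v i) := rfl

theorem isHomogeneousVec_vecComponent (a : ι → ℕ) (t : ℕ) (v : ι → MvPolynomial σ k) :
    IsHomogeneousVec a t (vecComponent a t v) := fun i =>
  ⟨fun h => by
    rw [vecComponent_apply, shiftComponent_of_le h]
    exact homogeneousComponent_isHomogeneous _ _,
  fun h => by rw [vecComponent_apply, shiftComponent_of_lt h]⟩

theorem vecComponent_smul {a : ι → ℕ} {b : ℕ} {w : ι → MvPolynomial σ k}
    (hw : IsHomogeneousVec a b w) (t : ℕ) (c : MvPolynomial σ k) :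
    vecComponent a t (c • w) = shiftComponent t b c • w := by
  funext i
  rw [vecComponent_apply, Pi.smul_apply, Pi.smul_apply, smul_eq_mul, smul_eq_mul]
  by_cases hb : a i ≤ b
  · have h := (hw i).1 hb
    by_cases ht : a i ≤ t
    · rw [shiftComponent_of_le ht, homogeneousComponent_mul_of_isHomogeneous h]
      congr 1
      by_cases hbt : b ≤ t
      · rw [shiftComponent_of_le hbt, shiftComponent_of_le (Nat.sub_le_sub_right hbt _),
          Nat.sub_sub_sub_cancel_right hb]
      · rw [shiftComponent_of_lt (by omega), shiftComponent_of_lt (by omega)]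
    · rw [shiftComponent_of_lt (by omega), shiftComponent_of_lt (by omega), zero_mul]
  · rw [(hw i).2 (by omega)]
    simp

theorem exists_sum_vecComponent [Finite ι] (a : ι → ℕ) (v : ι → MvPolynomial σ k) :
    ∃ N, v = ∑ t ∈ Finset.range N, vecComponent a t v := by
  have := Fintype.ofFinite ι
  refine ⟨∑ i, (a i + (v i).totalDegree + 1), funext fun i => ?_⟩
  set N := ∑ i, (a i + (v i).totalDegree + 1)
  have hN : a i + (v i).totalDegree + 1 ≤ N :=
    Finset.single_le_sum (f := fun i => a i + (v i).totalDegree + 1) (fun _ _ => Nat.zero_le _)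
      (Finset.mem_univ i)
  rw [Finset.sum_apply]
  simp only [vecComponent_apply]
  obtain ⟨N', hN'⟩ := Nat.exists_eq_add_of_le hN
  rw [hN', add_assoc (a i), add_assoc (a i), Finset.sum_range_add,
    Finset.sum_eq_zero fun t ht => shiftComponent_of_lt (Finset.mem_range.mp ht) _, zero_add]
  simp only [shiftComponent_of_le (Nat.le_add_right _ _), Nat.add_sub_cancel_left]
  rw [Finset.sum_range_add, sum_homogeneousComponent]
  rw [Finset.sum_eq_zero, add_zero]
  exact fun t _ => homogeneousComponent_eq_zero _ _ (by omega)

theorem linearCombination_vecComponent [Fintype ι] {a : ι → ℕ} {g : ι → MvPolynomial σ k}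
    (hg : ∀ i, (g i).IsHomogeneous (a i)) (t : ℕ) (v : ι → MvPolynomial σ k) :
    Fintype.linearCombination (MvPolynomial σ k) g (vecComponent a t v) =
      homogeneousComponent t (Fintype.linearCombination (MvPolynomial σ k) g v) := by
  simp only [Fintype.linearCombination_apply, smul_eq_mul, map_sum, vecComponent_apply]
  exact Finset.sum_congr rfl fun i _ => (homogeneousComponent_mul_of_isHomogeneous (hg i) _ _).symm

/-- A graded submodule of a free module of finite rank is generated by a finite set of homogeneous
elements. -/
theorem exists_finset_homogeneous_generators [Finite σ] [Finite ι] (a : ι → ℕ)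
    (K : Submodule (MvPolynomial σ k) (ι → MvPolynomial σ k))
    (hK : ∀ v ∈ K, ∀ t, vecComponent a t v ∈ K) :
    ∃ S : Finset (ι → MvPolynomial σ k), (∀ w ∈ S, ∃ b, IsHomogeneousVec a b w) ∧
      Submodule.span (MvPolynomial σ k) S = K := by
  classical
  obtain ⟨S, hS⟩ : K.FG := IsNoetherian.noetherian K
  choose N hN using exists_sum_vecComponent (k := k) (σ := σ) a
  refine ⟨S.biUnion fun v => (Finset.range (N v)).image fun t => vecComponent a t v, ?_, ?_⟩
  · intro w hw
    simp only [Finset.mem_biUnion, Finset.mem_image] at hw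
    obtain ⟨v, _, t, _, rfl⟩ := hw
    exact ⟨t, isHomogeneousVec_vecComponent _ _ _⟩
  · apply le_antisymm
    · rw [Submodule.span_le]
      intro w hw
      simp only [Finset.coe_biUnion, Finset.coe_image, Set.mem_iUnion, Set.mem_image] at hw
      obtain ⟨v, hv, t, _, rfl⟩ := hw
      exact hK v (hS ▸ Submodule.subset_span hv) t
    · rw [← hS, Submodule.span_le]
      intro v hv
      rw [hN v]
      refine Submodule.sum_mem _ fun t ht => Submodule.subset_span ?_
      simp only [Finset.coe_biUnion, Finset.coe_image, Set.mem_iUnion, Set.mem_image]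
      exact ⟨v, hv, t, ht, rfl⟩

/-- The homogeneous generators can be chosen independent modulo the ideal of the variables. -/
theorem exists_minimal_homogeneous_generators [Finite σ] [Finite ι] (a : ι → ℕ)
    (K : Submodule (MvPolynomial σ k) (ι → MvPolynomial σ k))
    (hK : ∀ v ∈ K, ∀ t, vecComponent a t v ∈ K) :
    ∃ (s : ℕ) (b : Fin s → ℕ) (w : Fin s → ι → MvPolynomial σ k),
      (∀ j, IsHomogeneousVec a (b j) (w j)) ∧
      Submodule.span (MvPolynomial σ k) (Set.range w) = K ∧
      ∀ e : Fin s → MvPolynomial σ k, ∑ j, e j • w j = 0 → ∀ j, constantCoeff (e j) = 0 := by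
  classical
  -- The generating set is taken of least cardinality among the homogeneous ones.
  have hex : ∃ s : ℕ, ∃ S : Finset (ι → MvPolynomial σ k), S.card = s ∧
      (∀ w ∈ S, ∃ b, IsHomogeneousVec a b w) ∧ Submodule.span (MvPolynomial σ k) S = K := by
    obtain ⟨S, h1, h2⟩ := exists_finset_homogeneous_generators a K hK
    exact ⟨_, S, rfl, h1, h2⟩
  obtain ⟨S, hcard, hhom, hspan⟩ := Nat.find_spec hex
  have hmin := fun s => Nat.find_min hex (m := s)
  generalize Nat.find hex = s at hcard hmin
  subst hcard
  choose! b hb using hhom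
  refine ⟨S.card, fun j => b (S.equivFin.symm j), fun j => S.equivFin.symm j,
    fun j => hb _ (S.equivFin.symm j).2, ?_, ?_⟩
  · rw [← hspan]
    congr 1
    ext w
    constructor
    · rintro ⟨j, rfl⟩
      exact (S.equivFin.symm j).2
    · intro hw
      exact ⟨S.equivFin ⟨w, hw⟩, by simp⟩
  · intro e he j
    by_contra hj
    set w : Fin S.card → ι → MvPolynomial σ k := fun j => S.equivFin.symm j with hw
    -- In the degree of `w j` the relation has a nonzero constant as coefficient of `w j`, so `w j`
    -- would be redundant.
    have h1 := congrArg (vecComponent a (b (w j))) he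
    rw [map_sum, map_zero] at h1
    have hwb : ∀ i, IsHomogeneousVec a (b (w i)) (w i) := fun i => hb _ (S.equivFin.symm i).2
    simp only [vecComponent_smul (hwb _)] at h1
    rw [← Finset.add_sum_erase _ _ (Finset.mem_univ j), shiftComponent_self] at h1
    have hmem : w j ∈ Submodule.span (MvPolynomial σ k) (S.erase (w j) : Set _) := by
      have h2 : w j = (C (constantCoeff (e j))⁻¹ : MvPolynomial σ k) •
          (C (constantCoeff (e j)) : MvPolynomial σ k) • w j := by
        rw [smul_smul, ← C_mul, inv_mul_cancel₀ hj, C_1, one_smul]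
      suffices h : (C (constantCoeff (e j)) : MvPolynomial σ k) • w j ∈
          Submodule.span (MvPolynomial σ k) (S.erase (w j) : Set _) by
        have := Submodule.smul_mem _ (C (constantCoeff (e j))⁻¹) h
        rwa [← h2] at this
      rw [eq_neg_of_add_eq_zero_left h1]
      refine Submodule.neg_mem _ (Submodule.sum_mem _ fun i hi =>
        Submodule.smul_mem _ _ (Submodule.subset_span ?_))
      rw [Finset.mem_coe, Finset.mem_erase]
      refine ⟨fun h => (Finset.mem_erase.mp hi).1 ?_, (S.equivFin.symm i).2⟩
      exact S.equivFin.symm.injective (Subtype.ext h)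
    refine hmin (S.erase (w j)).card (Finset.card_erase_lt_of_mem (S.equivFin.symm j).2)
      ⟨S.erase (w j), rfl, fun w hw => ⟨b w, hb w (Finset.mem_of_mem_erase hw)⟩, ?_⟩
    rw [← hspan]
    apply le_antisymm
    · exact Submodule.span_mono (by simp)
    · rw [Submodule.span_le]
      intro v hv
      by_cases hvw : v = w j
      · exact hvw ▸ hmem
      · exact Submodule.subset_span (by simpa [hvw] using hv)

end Graded

/-- Homogeneous generators of a saturated ideal have a free module of syzygies, with a homogeneous
basis. -/
theorem exists_basis_of_syzygies {r : ℕ} {a : Fin r → ℕ} {g : Fin r → Ring3 k}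
    (hg : ∀ i, (g i).IsHomogeneous (a i))
    (hsat : ∀ e, (∀ i, X i * e ∈ LinearMap.range (Fintype.linearCombination (Ring3 k) g)) →
      e ∈ LinearMap.range (Fintype.linearCombination (Ring3 k) g)) :
    ∃ (s : ℕ) (b : Fin s → ℕ) (φ : Matrix (Fin r) (Fin s) (Ring3 k)),
      (∀ i j, (a i ≤ b j → (φ i j).IsHomogeneous (b j - a i)) ∧ (b j < a i → φ i j = 0)) ∧
      LinearMap.range φ.mulVecLin = LinearMap.ker (Fintype.linearCombination (Ring3 k) g) ∧
      Function.Injective φ.mulVecLin := by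
  obtain ⟨s, b, w, hw, hspan, hind⟩ := exists_minimal_homogeneous_generators a
    (LinearMap.ker (Fintype.linearCombination (Ring3 k) g)) (fun v hv t => by
      rw [LinearMap.mem_ker, linearCombination_vecComponent hg, LinearMap.mem_ker.mp hv, map_zero])
  have hmul : ∀ c, (Matrix.of fun i j => w j i).mulVecLin c = ∑ j, c j • w j := by
    intro c
    ext1 i
    simp [Matrix.mulVec, dotProduct, mul_comm]
  refine ⟨s, b, Matrix.of fun i j => w j i, fun i j => hw j i, ?_, ?_⟩
  · rw [← hspan]
    ext v
    simp only [LinearMap.mem_range, hmul, Submodule.mem_span_range_iff_exists_fun]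
  · rw [← LinearMap.ker_eq_bot, LinearMap.ker_eq_bot']
    intro c hc
    rw [hmul] at hc
    have hwK : ∀ j, w j ∈ LinearMap.ker (Fintype.linearCombination (Ring3 k) g) := fun j =>
      hspan ▸ Submodule.subset_span ⟨j, rfl⟩
    refine linearIndependent_of_saturated _ hsat (fun j => ⟨w j, hwK j⟩) (fun c hc => ?_) c
      (Subtype.ext (by simpa using hc))
    have htop : (⊤ : Submodule (Ring3 k)
        (LinearMap.ker (Fintype.linearCombination (Ring3 k) g))) =
        Submodule.span _ (Set.range fun j => ⟨w j, hwK j⟩) := by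
      refine (eq_top_iff.mpr fun x _ => ?_).symm
      obtain ⟨c, hc⟩ := (Submodule.mem_span_range_iff_exists_fun _).mp (hspan.ge x.2)
      exact (Submodule.mem_span_range_iff_exists_fun _).mpr ⟨c, Subtype.ext (by simpa using hc)⟩
    rw [htop, Submodule.mem_ideal_smul_span_iff_exists_sum] at hc
    obtain ⟨d, hd, hdc⟩ := hc
    -- The coefficients `d` lie in the maximal ideal and `c - d` is a genuine relation, so
    -- minimality puts `c - d` there as well.
    have h0 := hind (fun j => c j - d j) (by
      rw [Finsupp.sum_fintype _ _ (by simp)] at hdc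
      have := congrArg Subtype.val hdc
      simp only [Submodule.coe_sum, Submodule.coe_smul] at this
      simp [sub_smul, Finset.sum_sub_distrib, this])
    intro j
    have h1 := h0 j
    have : c j - d j ∈ idealOfVars (Fin 3) k := by
      have := (mem_pow_idealOfVars_iff' 1 (c j - d j)).mpr (fun x hx => by
        have hx : x = 0 := by simpa [Finsupp.degree_eq_zero_iff] using hx
        rw [hx, ← constantCoeff_eq, h1])
      simpa using this
    simpa using Ideal.add_mem _ this (hd j)

/-! ### Hilbert functions, generation in two degrees, and the resolution. -/

theorem finrank_homogeneousSubmodule (t : ℕ) :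
    Module.finrank k (homogeneousSubmodule (Fin 3) k t) = (t + 2).choose 2 := by
  have hs : {d : Fin 3 →₀ ℕ | d.degree = t} =
      (Finset.univ.finsuppAntidiag t : Finset (Fin 3 →₀ ℕ)) := by
    ext d
    simp [Finset.mem_finsuppAntidiag, Finsupp.degree_eq_sum]
  rw [homogeneousSubmodule_eq_finsupp_supported,
    Module.finrank_eq_nat_card_basis (.ofRepr (AddMonoidAlgebra.supportedEquivFinsupp _)), hs]
  simp only [SetLike.coe_sort_coe, Nat.card_eq_fintype_card, Fintype.card_coe,
    Finset.card_finsuppAntidiag_nat_eq_choose, Finset.card_univ, Fintype.card_fin]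
  rw [show 3 + t - 1 = t + 2 by omega, Nat.choose_symm_add]

instance finite_homogeneousSubmodule (t : ℕ) :
    Module.Finite k (homogeneousSubmodule (Fin 3) k t) :=
  Module.Finite.iff_fg.mpr (homogeneousSubmodule_fg _ _ t)

instance finite_component (I : Ideal (Ring3 k)) (t : ℕ) : Module.Finite k (component I t) :=
  Submodule.finiteDimensional_of_le (inf_le_left : component I t ≤ homogeneousSubmodule _ k t)

theorem exists_eq_sum_X_mul {t : ℕ} {f : Ring3 k} (hf : f.IsHomogeneous (t + 1)) :
    ∃ g : Fin 3 → Ring3 k, (∀ i, (g i).IsHomogeneous t) ∧ f = ∑ i, X i * g i := by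
  have h : f ∈ idealOfVars (Fin 3) k := by
    have := (mem_pow_idealOfVars_iff' 1 f).mpr (fun x hx => hf.coeff_eq_zero (by omega))
    simpa using this
  obtain ⟨c, hc⟩ := Ideal.mem_span_range_iff_exists_fun.mp h
  refine ⟨fun i => homogeneousComponent t (c i),
    fun i => homogeneousComponent_isHomogeneous _ _, ?_⟩
  rw [← homogeneousComponent_eq_self hf, ← hc, map_sum]
  refine Finset.sum_congr rfl fun i _ => ?_
  rw [homogeneousComponent_mul_of_isHomogeneous (isHomogeneous_X _ _),
    shiftComponent_of_le (by omega), mul_comm, Nat.add_sub_cancel]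

/-- The Hilbert function of `I` determines that of the quotient by a linear form. -/
theorem exists_eq_add_linForm_mul {I : Ideal (Ring3 k)} {a : Fin 3 → k} (ha : a ≠ 0)
    (hreg : ∀ f, linForm a * f ∈ I → f ∈ I) {t : ℕ} (ht : hilb I (t + 1) = hilb I t + (t + 2))
    {f : Ring3 k} (hf : f.IsHomogeneous (t + 1)) :
    ∃ u ∈ component I (t + 1), ∃ f' : Ring3 k, f'.IsHomogeneous t ∧ f = u + linForm a * f' := by
  set L : Ring3 k →ₗ[k] Ring3 k := LinearMap.mulLeft k (linForm a)
  have hL : Function.Injective L := fun x y hxy => mul_left_cancel₀ (linForm_ne_zero ha) hxy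
  set B := (homogeneousSubmodule (Fin 3) k t).map L
  have hLhom : ∀ x : Ring3 k, x.IsHomogeneous t → (L x).IsHomogeneous (t + 1) := fun x hx => by
    rw [add_comm]; exact (isHomogeneous_linForm a).mul hx
  have hinf : component I (t + 1) ⊓ B = (component I t).map L := by
    apply le_antisymm
    · rintro _ ⟨h1, x, hx, rfl⟩
      exact ⟨x, ⟨hx, hreg x h1.2⟩, rfl⟩
    · rintro _ ⟨x, hx, rfl⟩
      exact ⟨⟨hLhom x hx.1, I.mul_mem_left _ hx.2⟩, x, hx.1, rfl⟩
  have hle : component I (t + 1) ⊔ B ≤ homogeneousSubmodule (Fin 3) k (t + 1) := by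
    refine sup_le inf_le_left ?_
    rintro _ ⟨x, hx, rfl⟩
    exact hLhom x hx
  have hdim := Submodule.finrank_sup_add_finrank_inf_eq (component I (t + 1)) B
  have hmap : ∀ N : Submodule k (Ring3 k), Module.finrank k (N.map L) = Module.finrank k N :=
    fun N => (Submodule.equivMapOfInjective L hL N).finrank_eq.symm
  rw [hinf, hmap, hmap, finrank_homogeneousSubmodule] at hdim
  -- The sum has dimension `h_I(t+1) + dim R_t - h_I(t) = (t + 2) + dim R_t`, which is `dim
  -- R_{t+1}`.
  have heq : component I (t + 1) ⊔ B = homogeneousSubmodule (Fin 3) k (t + 1) := by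
    refine Submodule.eq_of_le_of_finrank_eq hle ?_
    rw [finrank_homogeneousSubmodule, show t + 1 + 2 = (t + 2) + 1 by rfl, Nat.choose_succ_succ']
    simp only [hilb] at ht
    simp
    omega
  have := heq.ge hf
  obtain ⟨u, hu, _, ⟨f', hf', rfl⟩, h⟩ := Submodule.mem_sup.mp this
  exact ⟨u, hu, f', hf', h.symm⟩

/-- Multiplication of the degree `t` component of `I` by linear forms. -/
noncomputable def mulMap (I : Ideal (Ring3 k)) (t : ℕ) :
    (Fin 3 → component I t) →ₗ[k] Ring3 k :=
  ∑ i, LinearMap.mulLeft k (X i) ∘ₗ (component I t).subtype ∘ₗ LinearMap.proj i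

theorem mulMap_apply (I : Ideal (Ring3 k)) (t : ℕ) (f : Fin 3 → component I t) :
    mulMap I t f = ∑ i, X i * (f i : Ring3 k) := by
  simp [mulMap]

/-- Write `f = ∑ X_i g_i` and reduce each `g_i` to `u_i + ℓ g'_i` with `u_i` in `I`, where `ℓ =
linForm a`. Then `e = ∑ X_i g'_i` lies in `I`, since `ℓ e` does and `ℓ` is a nonzerodivisor modulo
`I`. As `ℓ = ∑ a_i X_i`, it follows that `f = ∑ X_i (u_i + a_i e)`. -/
theorem mem_range_mulMap_of_hilb {I : Ideal (Ring3 k)} {a : Fin 3 → k} (ha : a ≠ 0)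
    (hreg : ∀ f, linForm a * f ∈ I → f ∈ I) {t : ℕ} (ht : hilb I (t + 1) = hilb I t + (t + 2))
    {f : Ring3 k} (hf : f ∈ component I (t + 2)) : f ∈ LinearMap.range (mulMap I (t + 1)) := by
  obtain ⟨g, hg, hfg⟩ := exists_eq_sum_X_mul hf.1
  choose u hu g' hg' hgu using fun i => exists_eq_add_linForm_mul ha hreg ht (hg i)
  have hsub : linForm a * ∑ i, X i * g' i = f - ∑ i, X i * u i := by
    rw [hfg, Finset.mul_sum, ← Finset.sum_sub_distrib]
    refine Finset.sum_congr rfl fun i _ => ?_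
    rw [hgu i]; ring
  have he : ∑ i, X i * g' i ∈ component I (t + 1) := by
    refine ⟨IsHomogeneous.sum _ _ _ fun i _ => ?_, hreg _ ?_⟩
    · rw [add_comm]; exact (isHomogeneous_X _ _).mul (hg' i)
    · rw [hsub]
      exact I.sub_mem hf.2 (Ideal.sum_mem _ fun i _ => I.mul_mem_left _ (hu i).2)
  refine ⟨fun i => ⟨u i, hu i⟩ + a i • ⟨_, he⟩, ?_⟩
  rw [mulMap_apply, ← sub_eq_zero, ← sub_eq_zero.mpr hsub, linForm, Finset.sum_mul]
  simp only [Submodule.coe_add, Submodule.coe_smul, mul_add, Finset.sum_add_distrib, smul_eq_C_mul]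
  rw [Finset.sum_congr rfl fun i _ => (by ring : X i * (C (a i) * ∑ j, X j * g' j) =
    C (a i) * X i * ∑ j, X j * g' j)]
  ring

theorem mulMap_mem_component {I : Ideal (Ring3 k)} {t : ℕ} (f : Fin 3 → component I t) :
    mulMap I t f ∈ component I (t + 1) := by
  rw [mulMap_apply]
  refine Submodule.sum_mem _ fun i _ => ⟨?_, I.mul_mem_left _ (f i).2.2⟩
  rw [add_comm]; exact (isHomogeneous_X _ _).mul (f i).2.1

theorem mul_mem_range_mulMap {I : Ideal (Ring3 k)} {t : ℕ} {l f : Ring3 k}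
    (hl : l.IsHomogeneous 1) (hf : f ∈ component I t) : l * f ∈ LinearMap.range (mulMap I t) := by
  replace hl : l ∈ Submodule.span k (Set.range (X : Fin 3 → Ring3 k)) :=
    homogeneousSubmodule_one_eq_span_X (σ := Fin 3) (R := k) ▸ hl
  induction hl using Submodule.span_induction with
  | mem x hx =>
    obtain ⟨i, rfl⟩ := hx
    refine ⟨Pi.single i ⟨f, hf⟩, ?_⟩
    rw [mulMap_apply, Finset.sum_eq_single i] <;> simp +contextual
  | zero => simp
  | add x y _ _ hx hy => rw [add_mul]; exact Submodule.add_mem _ hx hy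
  | smul c x _ hx => rw [smul_mul_assoc]; exact Submodule.smul_mem _ _ hx

theorem exists_basis_complement {V : Type*} [AddCommGroup V] [Module k V] {A W : Submodule k V}
    [Module.Finite k A] (hWA : W ≤ A) :
    ∃ u : Fin (Module.finrank k A - Module.finrank k W) → V, (∀ j, u j ∈ A) ∧
      (∀ c : Fin _ → k, ∑ j, c j • u j ∈ W → c = 0) ∧
      ∀ x ∈ A, ∃ c : Fin _ → k, x - ∑ j, c j • u j ∈ W := by
  have hfin : Module.finrank k (A ⧸ W.submoduleOf A) =
      Module.finrank k A - Module.finrank k W := by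
    have h1 := Submodule.finrank_quotient_add_finrank (W.submoduleOf A)
    have h2 := (Submodule.submoduleOfEquivOfLe hWA).finrank_eq
    omega
  have B := Module.finBasisOfFinrankEq k (A ⧸ W.submoduleOf A) hfin
  choose u hu using fun j => Submodule.mkQ_surjective (W.submoduleOf A) (B j)
  have key : ∀ c : Fin _ → k, ∀ x : A, (x : V) - ∑ j, c j • (u j : V) ∈ W ↔
      (W.submoduleOf A).mkQ x = ∑ j, c j • B j := by
    intro c x
    have : (x : V) - ∑ j, c j • (u j : V) = ((x - ∑ j, c j • u j : A) : V) := by simp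
    rw [this, ← sub_eq_zero]
    simp only [← hu, ← map_smul, ← map_sum, ← map_sub]
    rw [Submodule.mkQ_apply, Submodule.Quotient.mk_eq_zero]
    rfl
  refine ⟨fun j => u j, fun j => (u j).2, fun c hc => ?_, fun x hx => ?_⟩
  · have := (key c 0).mp (by simpa using W.neg_mem hc)
    rw [map_zero] at this
    funext j
    exact Fintype.linearIndependent_iff.mp B.linearIndependent c this.symm j
  · refine ⟨fun j => B.repr ((W.submoduleOf A).mkQ ⟨x, hx⟩) j, (key _ ⟨x, hx⟩).mpr ?_⟩
    exact (B.sum_repr _).symm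

theorem constantCoeff_eq_zero_of_isHomogeneous {f : Ring3 k} {d : ℕ} (hd : d ≠ 0)
    (hf : f.IsHomogeneous d) : constantCoeff f = 0 := by
  rw [constantCoeff_eq]
  exact hf.coeff_eq_zero (by simpa using hd.symm)

theorem eq_C_of_isHomogeneous_zero {f : Ring3 k} (hf : f.IsHomogeneous 0) :
    f = C (constantCoeff f) := by
  conv_lhs => rw [← homogeneousComponent_eq_self hf, homogeneousComponent_zero]
  rw [constantCoeff_eq]

/-- A saturated homogeneous ideal that is generated in its initial degree `t` and in degree `t + 1`
has a minimal free resolution. -/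
theorem exists_isMinimalFreeResolution {I : Ideal (Ring3 k)} {t : ℕ}
    (hhom : ∀ f ∈ I, ∀ d, homogeneousComponent d f ∈ I)
    (hsat : ∀ e, (∀ i, X i * e ∈ I) → e ∈ I) (hlow : ∀ d < t, component I d = ⊥)
    (hgen : ∀ d, t ≤ d → ∀ f ∈ component I (d + 2), f ∈ LinearMap.range (mulMap I (d + 1))) :
    ∃ (r s : ℕ) (a : Fin r → ℕ) (b : Fin s → ℕ) (g : Fin r → Ring3 k)
      (φ : Matrix (Fin r) (Fin s) (Ring3 k)),
      IsMinimalFreeResolution I a b g φ ∧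
      r = hilb I t + (hilb I (t + 1) - Module.finrank k (LinearMap.range (mulMap I t))) := by
  have hW : LinearMap.range (mulMap I t) ≤ component I (t + 1) := by
    rintro _ ⟨f, rfl⟩
    exact mulMap_mem_component f
  set h := Module.finrank k (component I t) with hh
  set e := Module.finrank k (component I (t + 1)) -
    Module.finrank k (LinearMap.range (mulMap I t)) with he
  have B : Module.Basis (Fin h) k (component I t) := Module.finBasis k (component I t)
  obtain ⟨u, huI, hu0, hu1⟩ : ∃ u : Fin e → Ring3 k, (∀ j, u j ∈ component I (t + 1)) ∧
      (∀ c : Fin e → k, ∑ j, c j • u j ∈ LinearMap.range (mulMap I t) → c = 0) ∧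
      ∀ x ∈ component I (t + 1), ∃ c : Fin e → k,
        x - ∑ j, c j • u j ∈ LinearMap.range (mulMap I t) :=
    exists_basis_complement hW
  clear_value h e
  -- The generators are a basis of `I_t` and lifts of a basis of the cokernel of multiplication into
  -- `I_{t+1}`.
  set a : Fin (h + e) → ℕ := Fin.append (fun _ => t) fun _ => t + 1 with ha
  set g : Fin (h + e) → Ring3 k := Fin.append (fun i => (B i : Ring3 k)) u with hg
  have hga : ∀ i, (g i).IsHomogeneous (a i) := fun i => by
    refine Fin.addCases (fun i => ?_) (fun i => ?_) i
    · simpa [ha, hg] using (B i).2.1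
    · simpa [ha, hg] using (huI i).1
  have hgI : ∀ i, g i ∈ I := fun i => by
    refine Fin.addCases (fun i => ?_) (fun i => ?_) i
    · simpa [hg] using (B i).2.2
    · simpa [hg] using (huI i).2
  have hrange : LinearMap.range (Fintype.linearCombination (Ring3 k) g) = I := by
    rw [Fintype.range_linearCombination]
    apply le_antisymm
    · rw [Submodule.span_le]
      rintro _ ⟨i, rfl⟩
      exact hgI i
    · have hspan : ∀ d, ∀ f ∈ component I d, f ∈ Submodule.span (Ring3 k) (Set.range g) := by
        have hB : ∀ f ∈ component I t, f ∈ Submodule.span (Ring3 k) (Set.range g) := by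
          intro f hf
          have := congrArg Subtype.val (B.sum_repr ⟨f, hf⟩)
          simp only [Submodule.coe_sum, Submodule.coe_smul] at this
          rw [← this]
          refine Submodule.sum_mem _ fun i _ => ?_
          rw [← algebraMap_smul (Ring3 k)]
          exact Submodule.smul_mem _ _ (Submodule.subset_span ⟨Fin.castAdd e i, by simp [hg]⟩)
        have hmul : ∀ d, (∀ f ∈ component I d, f ∈ Submodule.span (Ring3 k) (Set.range g)) →
            ∀ f ∈ LinearMap.range (mulMap I d), f ∈ Submodule.span (Ring3 k) (Set.range g) := by
          rintro d hd _ ⟨f, rfl⟩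
          rw [mulMap_apply]
          exact Submodule.sum_mem _ fun i _ => Submodule.smul_mem _ _ (hd _ (f i).2)
        intro d
        rcases lt_or_ge d t with hd | hd
        · intro f hf
          rw [hlow d hd, Submodule.mem_bot] at hf
          rw [hf]
          exact Submodule.zero_mem _
        · obtain ⟨n, rfl⟩ := Nat.exists_eq_add_of_le hd
          clear hd
          induction n with
          | zero => exact hB
          | succ n ih =>
            rcases n with _ | n
            · intro f hf
              obtain ⟨c, hc⟩ := hu1 f hf
              have := hmul t hB _ hc
              rw [← sub_add_cancel f (∑ j, c j • u j)]
              refine Submodule.add_mem _ this (Submodule.sum_mem _ fun j _ => ?_)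
              rw [← algebraMap_smul (Ring3 k)]
              exact Submodule.smul_mem _ _ (Submodule.subset_span ⟨Fin.natAdd h j, by simp [hg]⟩)
            · intro f hf
              exact hmul _ ih _ (hgen (t + n) (Nat.le_add_right _ _) f hf)
      intro f hf
      rw [← sum_homogeneousComponent f]
      exact Submodule.sum_mem _ fun d _ =>
        hspan d _ ⟨homogeneousComponent_isHomogeneous _ _, hhom f hf d⟩
  obtain ⟨s, b, φ, hφ, hexact, hinj⟩ := exists_basis_of_syzygies hga (by rwa [hrange])
  refine ⟨h + e, s, a, b, g, φ, ⟨hga, hφ, hrange, hexact, hinj, ?_⟩, by rw [hh, he]; rfl⟩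
  intro i j
  have hker : ∑ i, φ i j * g i = 0 := by
    have : φ.mulVecLin (Pi.single j 1) ∈ LinearMap.ker (Fintype.linearCombination (Ring3 k) g) :=
      hexact ▸ LinearMap.mem_range_self _ _
    simpa [Fintype.linearCombination_apply] using this
  rw [Fin.sum_univ_add] at hker
  have h1 : ∀ i : Fin h, a (Fin.castAdd e i) = t := by simp [ha]
  have h2 : ∀ i : Fin e, a (Fin.natAdd h i) = t + 1 := by simp [ha]
  have h3 : ∀ i : Fin h, g (Fin.castAdd e i) = B i := by simp [hg]
  have h4 : ∀ i : Fin e, g (Fin.natAdd h i) = u i := by simp [hg]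
  have hpos : ∀ i, a i ≠ b j → constantCoeff (φ i j) = 0 := by
    intro i hi
    rcases lt_or_gt_of_ne hi with hi | hi
    · exact constantCoeff_eq_zero_of_isHomogeneous (by omega) ((hφ i j).1 hi.le)
    · rw [(hφ i j).2 hi, map_zero]
  have hC : ∀ i, a i = b j → φ i j = C (constantCoeff (φ i j)) := fun i hi =>
    eq_C_of_isHomogeneous_zero (by simpa [hi] using (hφ i j).1 hi.le)
  -- A nonzero constant entry requires `a i = b j`. In degree `t` it would be a linear relation in
  -- the basis `B`; in degree `t + 1`, a relation among the `u` modulo the image of `mulMap`.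
  by_cases hi : a i = b j
  swap
  · exact hpos i hi
  revert hi
  refine Fin.addCases (fun i => ?_) (fun i => ?_) i
  · intro hi
    rw [h1] at hi
    have hz : ∑ i, φ (Fin.natAdd h i) j * g (Fin.natAdd h i) = 0 :=
      Finset.sum_eq_zero fun i _ => by rw [(hφ _ j).2 (by rw [h2]; omega), zero_mul]
    rw [hz, add_zero] at hker
    have := Fintype.linearIndependent_iff.mp B.linearIndependent
      (fun i => constantCoeff (φ (Fin.castAdd e i) j)) (Subtype.ext (by
        simp only [Submodule.coe_sum, Submodule.coe_smul, Submodule.coe_zero]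
        rw [← hker]
        refine Finset.sum_congr rfl fun i _ => ?_
        rw [h3, hC (Fin.castAdd e i) (by rw [h1]; exact hi), constantCoeff_C, C_mul']))
    exact this i
  · intro hi
    rw [h2] at hi
    have hz : ∑ i, constantCoeff (φ (Fin.natAdd h i) j) • u i ∈ LinearMap.range (mulMap I t) := by
      have : ∑ i, constantCoeff (φ (Fin.natAdd h i) j) • u i =
          ∑ i, φ (Fin.natAdd h i) j * g (Fin.natAdd h i) :=
        Finset.sum_congr rfl fun i _ => by
          conv_rhs => rw [h4, hC (Fin.natAdd h i) (by rw [h2]; exact hi), C_mul']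
      rw [this, eq_neg_of_add_eq_zero_right hker]
      refine Submodule.neg_mem _ (Submodule.sum_mem _ fun i _ => ?_)
      rw [h3]
      refine mul_mem_range_mulMap ?_ (B i).2
      have := (hφ (Fin.castAdd e i) j).1 (by rw [h1]; omega)
      rwa [h1, ← hi, Nat.add_sub_cancel_left] at this
    exact congrFun (hu0 _ hz) i

/-! ### Linear forms through a point and the cross product. -/

theorem linForm_single (j : Fin 3) : linForm (Pi.single j 1 : Fin 3 → k) = X j := by
  simp [linForm, Pi.single_apply, apply_ite (C : k → Ring3 k), ite_mul]

theorem prime_linForm {a : Fin 3 → k} (ha : a ≠ 0) : Prime (linForm a) := by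
  have h1 : (linForm a).totalDegree = 1 :=
    (isHomogeneous_linForm a).totalDegree (linForm_ne_zero ha)
  refine (irreducible_of_totalDegree_eq_one h1 fun x hx => ?_).prime
  obtain ⟨j, hj⟩ := Function.ne_iff.mp ha
  have := hx (Finsupp.single j 1)
  rw [coeff_linForm] at this
  exact isUnit_of_dvd_unit this (isUnit_iff_ne_zero.mpr hj)

/-- The point `w` lies on the first line and not on the second, so the first form, a prime, does not
divide the second. -/
theorem linForm_dvd_of_dvd_mul {a b w : Fin 3 → k} {f : Ring3 k} (ha : a ≠ 0)
    (haw : a ⬝ᵥ w = 0) (hbw : b ⬝ᵥ w ≠ 0) (h : linForm a ∣ linForm b * f) : linForm a ∣ f := by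
  refine ((prime_linForm ha).dvd_or_dvd h).resolve_left ?_
  rintro ⟨c, hc⟩
  have := congrArg (eval w) hc
  rw [map_mul, eval_linForm, eval_linForm, haw, zero_mul] at this
  exact hbw this

/-- The rows of the matrix of the linear map `w ↦ w × v`. -/
def crossRow (v : Fin 3 → k) : Fin 3 → Fin 3 → k :=
  ![![0, v 2, -v 1], ![-v 2, 0, v 0], ![v 1, -v 0, 0]]

theorem crossRow_dotProduct (v w : Fin 3 → k) (i : Fin 3) :
    crossRow v i ⬝ᵥ w = (crossProduct w v) i := by
  fin_cases i <;> simp [crossRow, dotProduct, Fin.sum_univ_three, cross_apply] <;> ring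

theorem crossRow_dotProduct_self (v : Fin 3 → k) (i : Fin 3) : crossRow v i ⬝ᵥ v = 0 := by
  rw [crossRow_dotProduct, cross_self]; rfl

theorem crossRow_zero (v : Fin 3 → k) : linForm (crossRow v 0) = C (v 2) * X 1 - C (v 1) * X 2 := by
  simp [linForm, crossRow, Fin.sum_univ_three]; ring
theorem crossRow_one (v : Fin 3 → k) : linForm (crossRow v 1) = C (v 0) * X 2 - C (v 2) * X 0 := by
  simp [linForm, crossRow, Fin.sum_univ_three]; ring
theorem crossRow_two (v : Fin 3 → k) : linForm (crossRow v 2) = C (v 1) * X 0 - C (v 0) * X 1 := by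
  simp [linForm, crossRow, Fin.sum_univ_three]; ring

theorem exists_of_linForm_mul_eq {a b w : Fin 3 → k} {f g : Ring3 k}
    (haw : a ⬝ᵥ w = 0) (hbw : b ⬝ᵥ w ≠ 0) (ha : a ≠ 0) (h : linForm a * g = linForm b * f) :
    ∃ e, f = linForm a * e ∧ g = linForm b * e := by
  obtain ⟨e, rfl⟩ := linForm_dvd_of_dvd_mul ha haw hbw ⟨g, h.symm⟩
  refine ⟨e, rfl, mul_left_cancel₀ (linForm_ne_zero ha) ?_⟩
  rw [h]; ring

/-- A vector of polynomials orthogonal to `v` and to `(X 0, X 1, X 2)` is a multiple of the cross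
product of these vectors. -/
theorem exists_eq_crossRow_mul {v : Fin 3 → k} (hv : v ≠ 0) {f : Fin 3 → Ring3 k}
    (hX : ∑ i, X i * f i = 0) (hf : ∑ i, C (v i) * f i = 0) :
    ∃ e, ∀ i, f i = linForm (crossRow v i) * e := by
  rw [Fin.sum_univ_three] at hX hf
  obtain ⟨j, hj⟩ := Function.ne_iff.mp hv
  have h01 : linForm (crossRow v 0) * f 1 = linForm (crossRow v 1) * f 0 := by
    rw [crossRow_zero, crossRow_one]; linear_combination C (v 2) * hX - X 2 * hf
  have h12 : linForm (crossRow v 1) * f 2 = linForm (crossRow v 2) * f 1 := by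
    rw [crossRow_one, crossRow_two]; linear_combination C (v 0) * hX - X 0 * hf
  have h20 : linForm (crossRow v 2) * f 0 = linForm (crossRow v 0) * f 2 := by
    rw [crossRow_two, crossRow_zero]; linear_combination C (v 1) * hX - X 1 * hf
  have hne : ∀ i j, crossRow v i j ≠ 0 → crossRow v i ≠ 0 := fun i j h h' => h (by rw [h']; rfl)
  -- When `v j ≠ 0`, the other two rows are coprime forms, separated by a coordinate vector, and
  -- yield `e`. The entry `f j` is then solved from `∑ v_i f_i = 0`.
  fin_cases j
  · simp only [Fin.zero_eta, Pi.zero_apply] at hj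
    obtain ⟨e, h1, h2⟩ := exists_of_linForm_mul_eq (w := Pi.single 1 1) (by simp [crossRow])
      (by simpa [crossRow] using hj) (hne 1 2 (by simpa [crossRow] using hj)) h12
    refine ⟨e, fun i => ?_⟩
    fin_cases i
    · refine mul_left_cancel₀ (C_ne_zero.mpr hj) ?_
      simp only [Fin.zero_eta]
      rw [h1, h2, crossRow_one, crossRow_two] at hf
      rw [crossRow_zero]
      linear_combination hf
    · exact h1
    · exact h2
  · simp only [Fin.mk_one, Pi.zero_apply] at hj
    obtain ⟨e, h1, h2⟩ := exists_of_linForm_mul_eq (w := Pi.single 2 1) (by simp [crossRow])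
      (by simpa [crossRow] using hj) (hne 2 0 (by simpa [crossRow] using hj)) h20
    refine ⟨e, fun i => ?_⟩
    fin_cases i
    · exact h2
    · refine mul_left_cancel₀ (C_ne_zero.mpr hj) ?_
      simp only [Fin.mk_one]
      rw [h1, h2, crossRow_zero, crossRow_two] at hf
      rw [crossRow_one]
      linear_combination hf
    · exact h1
  · simp only [Fin.reduceFinMk, Pi.zero_apply] at hj
    obtain ⟨e, h1, h2⟩ := exists_of_linForm_mul_eq (w := Pi.single 0 1) (by simp [crossRow])
      (by simpa [crossRow] using hj) (hne 0 1 (by simpa [crossRow] using hj)) h01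
    refine ⟨e, fun i => ?_⟩
    fin_cases i
    · exact h1
    · exact h2
    · refine mul_left_cancel₀ (C_ne_zero.mpr hj) ?_
      simp only [Fin.reduceFinMk]
      rw [h1, h2, crossRow_one, crossRow_zero] at hf
      rw [crossRow_two]
      linear_combination hf

/-! ### Initial degree, unhindered ideals, and the kernel of multiplication. -/

section Points

variable {n : ℕ} (p : Fin n → Plane k) (m : Fin n → ℕ)

theorem mem_fatIdeal_of_linForm_mul {a : Fin 3 → k} (ha : ∀ i, a ⬝ᵥ (p i).rep ≠ 0) {f : Ring3 k}
    (hf : linForm a * f ∈ fatIdeal p m) : f ∈ fatIdeal p m := by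
  rw [mem_fatIdeal_iff] at hf ⊢
  intro i
  have := hf i
  rwa [ord_mul, ord_linForm_of_ne (ha i), zero_add] at this

theorem ord_X {v : Fin 3 → k} {j : Fin 3} (hj : v j ≠ 0) : ord v (X j) = 0 := by
  rw [← linForm_single]
  exact ord_linForm_of_ne (by simpa using hj)

theorem fatIdeal_saturated {f : Ring3 k} (hf : ∀ j, X j * f ∈ fatIdeal p m) :
    f ∈ fatIdeal p m := by
  rw [mem_fatIdeal_iff]
  intro i
  obtain ⟨j, hj⟩ := Function.ne_iff.mp (p i).rep_nonzero
  have := (mem_fatIdeal_iff p m _).mp (hf j) i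
  rwa [ord_mul, ord_X hj, zero_add] at this

theorem exists_linForm_ne_zero [Infinite k] : ∃ a : Fin 3 → k, ∀ i, a ⬝ᵥ (p i).rep ≠ 0 := by
  have h : ∏ i, linForm (p i).rep ≠ 0 :=
    Finset.prod_ne_zero_iff.mpr fun i _ => linForm_ne_zero (p i).rep_nonzero
  by_contra! hcon
  refine h (MvPolynomial.funext fun a => ?_)
  obtain ⟨i, hi⟩ := hcon a
  rw [map_prod, map_zero]
  refine Finset.prod_eq_zero (Finset.mem_univ i) ?_
  rw [eval_linForm, dotProduct_comm, hi]

theorem exists_crossRow_ne_zero {v : Fin 3 → k} (hv : v ≠ 0) : ∃ i, crossRow v i ≠ 0 := by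
  obtain ⟨j, hj⟩ := Function.ne_iff.mp hv
  fin_cases j
  · exact ⟨1, Function.ne_iff.mpr ⟨2, by simpa [crossRow] using hj⟩⟩
  · exact ⟨0, Function.ne_iff.mpr ⟨2, by simpa [crossRow] using hj⟩⟩
  · exact ⟨0, Function.ne_iff.mpr ⟨1, by simpa [crossRow] using hj⟩⟩

theorem exists_orthogonal {v : Fin 3 → k} (hv : v ≠ 0) : ∃ a : Fin 3 → k, a ≠ 0 ∧ a ⬝ᵥ v = 0 := by
  obtain ⟨i, hi⟩ := exists_crossRow_ne_zero hv
  exact ⟨_, hi, crossRow_dotProduct_self v i⟩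

/-- A product of lines through the points shows that `alpha` is attained and bounds it independently
of the points. -/
theorem component_sum_ne_bot : component (fatIdeal p m) (∑ i, m i) ≠ ⊥ := by
  choose a ha hav using fun i => exists_orthogonal (p i).rep_nonzero
  have hhom : (∏ i, linForm (a i) ^ m i).IsHomogeneous (∑ i, m i) :=
    IsHomogeneous.prod _ _ _ fun i _ => by simpa using (isHomogeneous_linForm (a i)).pow (m i)
  have hmem : ∏ i, linForm (a i) ^ m i ∈ fatIdeal p m := by
    rw [fatIdeal, Ideal.mem_iInf]
    intro i
    obtain ⟨c, hc⟩ := Finset.dvd_prod_of_mem (fun i => linForm (a i) ^ m i) (Finset.mem_univ i)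
    rw [hc]
    refine Ideal.mul_mem_right _ _ ?_
    refine Ideal.pow_mem_pow ?_ _
    rw [pointIdeal]
    exact Ideal.subset_span ⟨1, isHomogeneous_linForm _, by rw [eval_linForm, hav]⟩
  intro h
  have : ∏ i, linForm (a i) ^ m i ∈ component (fatIdeal p m) (∑ i, m i) := ⟨hhom, hmem⟩
  rw [h, Submodule.mem_bot] at this
  exact Finset.prod_ne_zero_iff.mpr (fun i _ => pow_ne_zero _ (linForm_ne_zero (ha i))) this

theorem component_alpha_ne_bot : component (fatIdeal p m) (alpha (fatIdeal p m)) ≠ ⊥ :=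
  Nat.sInf_mem (s := {t | component (fatIdeal p m) t ≠ ⊥}) ⟨_, component_sum_ne_bot p m⟩

theorem alpha_le_sum : alpha (fatIdeal p m) ≤ ∑ i, m i :=
  Nat.sInf_le (component_sum_ne_bot p m)

theorem component_eq_bot_of_lt {t : ℕ} (ht : t < alpha (fatIdeal p m)) :
    component (fatIdeal p m) t = ⊥ :=
  not_not.mp (Nat.notMem_of_lt_sInf ht)

theorem hilb_eq_zero_iff (I : Ideal (Ring3 k)) (t : ℕ) : hilb I t = 0 ↔ component I t = ⊥ :=
  Submodule.finrank_eq_zero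

theorem hilb_alpha_pos : 0 < hilb (fatIdeal p m) (alpha (fatIdeal p m)) :=
  Nat.pos_of_ne_zero fun h => component_alpha_ne_bot p m ((hilb_eq_zero_iff _ _).mp h)

variable {p m}

theorem two_dvd_mul_add_one (a : ℤ) : 2 ∣ a * (a + 1) := (Int.even_mul_succ_self a).two_dvd

theorem Unhindered.eq_or (h : Unhindered p m) (t : ℕ) :
    (hilb (fatIdeal p m) t = 0 ∧
      ((t : ℤ) + 1) * (t + 2) - ∑ i, (m i : ℤ) * (m i + 1) ≤ 0) ∨
    2 * (hilb (fatIdeal p m) t : ℤ) = ((t : ℤ) + 1) * (t + 2) - ∑ i, (m i : ℤ) * (m i + 1) := by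
  have h1 := h t
  have h2 : (2 : ℤ) ∣ ((t : ℤ) + 1) * (t + 2) - ∑ i, (m i : ℤ) * (m i + 1) := by
    refine dvd_sub ?_ (Finset.dvd_sum fun i _ => two_dvd_mul_add_one _)
    have := two_dvd_mul_add_one ((t : ℤ) + 1)
    rwa [add_assoc, one_add_one_eq_two] at this
  generalize ((t : ℤ) + 1) * (t + 2) - ∑ i, (m i : ℤ) * (m i + 1) = z at *
  omega

/-- The expected dimension is positive at `alpha` and increases with `t`, so the maximum with zero
plays no role from there on. -/
theorem Unhindered.two_mul_hilb (h : Unhindered p m) {t : ℕ} (ht : alpha (fatIdeal p m) ≤ t) :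
    2 * (hilb (fatIdeal p m) t : ℤ) = ((t : ℤ) + 1) * (t + 2) - ∑ i, (m i : ℤ) * (m i + 1) := by
  have h0 : 0 < ((alpha (fatIdeal p m) : ℤ) + 1) * (alpha (fatIdeal p m) + 2)
      - ∑ i, (m i : ℤ) * (m i + 1) := by
    have := hilb_alpha_pos p m
    rcases h.eq_or (alpha (fatIdeal p m)) with h1 | h1 <;> omega
  refine (h.eq_or t).resolve_left fun h1 => ?_
  have : ((alpha (fatIdeal p m) : ℤ) + 1) * (alpha (fatIdeal p m) + 2) ≤
      ((t : ℤ) + 1) * (t + 2) := by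
    have : (alpha (fatIdeal p m) : ℤ) ≤ t := by exact_mod_cast ht
    nlinarith
  omega

theorem Unhindered.hilb_succ (h : Unhindered p m) {t : ℕ} (ht : alpha (fatIdeal p m) ≤ t) :
    hilb (fatIdeal p m) (t + 1) = hilb (fatIdeal p m) t + (t + 2) := by
  have h1 := h.two_mul_hilb ht
  have h2 := h.two_mul_hilb (ht.trans (Nat.le_succ t))
  push_cast at h2
  zify
  linarith

theorem Unhindered.mem_range_mulMap [Infinite k] [NeZero n] (h : Unhindered p m) {t : ℕ}
    (ht : alpha (fatIdeal p m) ≤ t) {f : Ring3 k} (hf : f ∈ component (fatIdeal p m) (t + 2)) :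
    f ∈ LinearMap.range (mulMap (fatIdeal p m) (t + 1)) := by
  obtain ⟨a, ha⟩ := exists_linForm_ne_zero p
  have ha0 : a ≠ 0 := by
    rintro rfl
    exact ha 0 (zero_dotProduct _)
  exact mem_range_mulMap_of_hilb ha0 (fun _ => mem_fatIdeal_of_linForm_mul p m ha)
    (h.hilb_succ ht) hf

theorem finrank_mulMap_domain (I : Ideal (Ring3 k)) (t : ℕ) :
    Module.finrank k (Fin 3 → component I t) = 3 * hilb I t := by
  rw [Module.finrank_pi_fintype]
  simp [hilb]

/-- An unhindered ideal is rank minimal if the multiplication map in the initial degree has maximal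
rank. -/
theorem Unhindered.rankMinimal [Infinite k] [NeZero n] (h : Unhindered p m)
    (hrank : LinearMap.ker (mulMap (fatIdeal p m) (alpha (fatIdeal p m))) = ⊥ ∨
      hilb (fatIdeal p m) (alpha (fatIdeal p m) + 1) ≤
        Module.finrank k (LinearMap.range (mulMap (fatIdeal p m) (alpha (fatIdeal p m))))) :
    RankMinimal p m := by
  obtain ⟨r, s, a, b, g, φ, hres, hr⟩ := exists_isMinimalFreeResolution
    (fun f hf d => homogeneousComponent_mem_fatIdeal p m hf d)
    (fun f hf => fatIdeal_saturated p m hf) (fun d hd => component_eq_bot_of_lt p m hd)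
    (fun d hd f hf => h.mem_range_mulMap hd hf)
  refine ⟨h, r, s, a, b, g, φ, hres, ?_⟩
  have hsum := LinearMap.finrank_range_add_finrank_ker
    (mulMap (fatIdeal p m) (alpha (fatIdeal p m)))
  rw [finrank_mulMap_domain] at hsum
  have hsucc := h.hilb_succ le_rfl
  have hle : Module.finrank k (LinearMap.range (mulMap (fatIdeal p m) (alpha (fatIdeal p m)))) ≤
      hilb (fatIdeal p m) (alpha (fatIdeal p m) + 1) := by
    refine Submodule.finrank_mono ?_
    rintro _ ⟨f, rfl⟩
    exact mulMap_mem_component f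
  -- If multiplication is injective its rank is `3h`, so `r = α + 2 - h ≥ h`; if it is onto, `r =
  -- h`.
  rcases hrank with hrank | hrank
  · rw [hrank, finrank_bot] at hsum
    omega
  · omega

variable [NeZero n]

theorem mem_fatIdeal_update_iff {c : ℕ} {f : Ring3 k} :
    f ∈ fatIdeal p (Function.update m 0 c) ↔
      (c : ℕ∞) ≤ ord (p 0).rep f ∧ ∀ i ≠ 0, (m i : ℕ∞) ≤ ord (p i).rep f := by
  rw [mem_fatIdeal_iff]
  constructor
  · intro h
    exact ⟨by simpa using h 0, fun i hi => by simpa [hi] using h i⟩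
  · rintro ⟨h0, h⟩ i
    by_cases hi : i = 0
    · subst hi; simpa using h0
    · simpa [hi] using h i hi

/-- Subtracting `v_j ∑ X_i f_i = 0` from `X_j ∑ v_i f_i` leaves coefficients `v_i X_j - v_j X_i`
that vanish at `v`. Choosing `v_j ≠ 0` makes the factor `X_j` free of charge. -/
theorem succ_le_ord_of_sum_X_mul_eq_zero {v : Plane k} {c : ℕ} {f : Fin 3 → Ring3 k}
    (hf : ∀ i, (c : ℕ∞) ≤ ord v.rep (f i)) (hX : ∑ i, X i * f i = 0) :
    ((c + 1 : ℕ) : ℕ∞) ≤ ord v.rep (∑ i, C (v.rep i) * f i) := by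
  obtain ⟨j, hj⟩ := Function.ne_iff.mp v.rep_nonzero
  have h1 : X j * ∑ i, C (v.rep i) * f i =
      ∑ i, linForm (Pi.single j (v.rep i) - Pi.single i (v.rep j)) * f i := by
    have : X j * ∑ i, C (v.rep i) * f i = X j * ∑ i, C (v.rep i) * f i -
      C (v.rep j) * ∑ i, X i * f i := by rw [hX]; ring
    rw [this, Finset.mul_sum, Finset.mul_sum, ← Finset.sum_sub_distrib]
    refine Finset.sum_congr rfl fun i _ => ?_
    have : linForm (Pi.single j (v.rep i) - Pi.single i (v.rep j)) =
        C (v.rep i) * X j - C (v.rep j) * X i := by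
      simp [linForm, sub_mul, Pi.single_apply, apply_ite (C : k → Ring3 k), ite_mul]
    rw [this]
    ring
  have h2 : ((c + 1 : ℕ) : ℕ∞) ≤ ord v.rep (X j * ∑ i, C (v.rep i) * f i) := by
    rw [h1, ← mem_pointIdeal_pow_iff]
    refine Ideal.sum_mem _ fun i _ => ?_
    rw [mem_pointIdeal_pow_iff, ord_mul, add_comm c 1]
    push_cast
    refine add_le_add (one_le_ord_linForm ?_) (hf i)
    simp [sub_dotProduct, mul_comm]
  rwa [ord_mul, ord_X hj, zero_add] at h2

theorem sum_rep_mul_mem_component {t : ℕ} {f : Fin 3 → component (fatIdeal p m) t}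
    (hf : mulMap (fatIdeal p m) t f = 0) :
    ∑ i, C ((p 0).rep i) * (f i : Ring3 k) ∈ component (fatIdeal p (mPrime m)) t := by
  rw [mulMap_apply] at hf
  refine ⟨IsHomogeneous.sum _ _ _ fun i _ => (f i).2.1.C_mul _,
    mem_fatIdeal_update_iff.mpr ⟨?_, ?_⟩⟩
  · exact succ_le_ord_of_sum_X_mul_eq_zero
      (fun i => (mem_fatIdeal_iff p m _).mp (f i).2.2 0) hf
  · intro j _
    exact (mem_fatIdeal_iff p m _).mp
      (Ideal.sum_mem _ fun i _ => Ideal.mul_mem_left _ _ (f i).2.2) j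

theorem exists_crossRow_dotProduct_ne_zero {v w : Plane k} (h : v ≠ w) :
    ∃ i, crossRow v.rep i ⬝ᵥ w.rep ≠ 0 := by
  by_contra! hcon
  have h0 : crossProduct w.rep v.rep = 0 := by
    funext i
    rw [← crossRow_dotProduct, hcon i]; rfl
  have := crossProduct_ne_zero_iff_linearIndependent (v := w.rep) (w := v.rep)
  rw [h0] at this
  simp only [ne_eq, not_true_eq_false, false_iff] at this
  refine this ?_
  rw [LinearIndependent.pair_iff' w.rep_nonzero]
  intro c hc
  apply h
  rw [← v.mk_rep, ← w.mk_rep, Projectivization.mk_eq_mk_iff']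
  exact ⟨c, hc⟩

/-- A line has order at most one at the first point, so dividing by it costs at most one there. At
each other point some row of `crossRow` does not vanish, and dividing by that row costs nothing. -/
theorem mem_component_mDoublePrime (hp : ∀ i ≠ 0, p i ≠ p 0) {t : ℕ} {e : Ring3 k}
    (he : ∀ i, linForm (crossRow (p 0).rep i) * e ∈ component (fatIdeal p m) (t + 1)) :
    e ∈ component (fatIdeal p (mDoublePrime m)) t := by
  obtain ⟨i, ha⟩ := exists_crossRow_ne_zero (p 0).rep_nonzero
  have hi' := he i
  set a := crossRow (p 0).rep i
  refine ⟨?_, mem_fatIdeal_update_iff.mpr ⟨?_, fun j hj => ?_⟩⟩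
  · have h1 := homogeneousComponent_mul_of_isHomogeneous (isHomogeneous_linForm a) (t + 1) e
    rw [mul_comm e, homogeneousComponent_eq_self hi'.1, shiftComponent_of_le (by omega),
      Nat.add_sub_cancel, mul_comm _ (linForm a)] at h1
    have h2 := mul_left_cancel₀ (linForm_ne_zero ha) h1
    rw [h2]
    exact homogeneousComponent_isHomogeneous _ _
  · have h1 := (mem_fatIdeal_iff p m _).mp hi'.2 0
    rw [ord_mul] at h1
    have h2 := h1.trans (add_le_add_left (ord_linForm_le (p 0).rep ha) _)
    push_cast
    exact tsub_le_iff_left.mpr h2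
  · obtain ⟨l, hl⟩ := exists_crossRow_dotProduct_ne_zero (hp j hj).symm
    have h1 := (mem_fatIdeal_iff p m _).mp (he l).2 j
    rwa [ord_mul, ord_linForm_of_ne hl, zero_add] at h1

/-- The kernel of multiplication by linear forms is bounded by the Hilbert functions of the ideals
with the first multiplicity raised and lowered. -/
theorem finrank_ker_mulMap_le (hp : ∀ i ≠ 0, p i ≠ p 0) (t : ℕ) :
    Module.finrank k (LinearMap.ker (mulMap (fatIdeal p m) t)) ≤
      hilb (fatIdeal p (mPrime m)) t +
        if t = 0 then 0 else hilb (fatIdeal p (mDoublePrime m)) (t - 1) := by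
  set I := fatIdeal p m
  set N := LinearMap.ker (mulMap I t)
  let D : N →ₗ[k] component (fatIdeal p (mPrime m)) t :=
    LinearMap.codRestrict _ ((∑ i, LinearMap.mulLeft k (C ((p 0).rep i)) ∘ₗ
      (component I t).subtype ∘ₗ LinearMap.proj i) ∘ₗ N.subtype) fun f => by
        have := sum_rep_mul_mem_component (LinearMap.mem_ker.mp f.2)
        simpa using this
  have hD : ∀ f : N, (D f : Ring3 k) = ∑ i, C ((p 0).rep i) * (f.1 i : Ring3 k) := fun f => by
    simp [D]
  have h1 := LinearMap.finrank_range_add_finrank_ker (K := k) (V := N) D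
  have h2 : Module.finrank k (LinearMap.range D) ≤ hilb (fatIdeal p (mPrime m)) t :=
    Submodule.finrank_le _
  -- The kernel of `D` is orthogonal to `X` and to the point, hence parametrised by a single form
  -- `e`.
  have hcross : ∀ f ∈ LinearMap.ker D,
      ∃ e, ∀ i, (f.1 i : Ring3 k) = linForm (crossRow (p 0).rep i) * e := fun f hf =>
    exists_eq_crossRow_mul (p 0).rep_nonzero
      (by rw [← mulMap_apply]; exact f.2) (by rw [← hD, LinearMap.mem_ker.mp hf]; rfl)
  refine h1.symm.le.trans (add_le_add h2 ?_)
  rcases t with _ | t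
  -- In degree zero, a constant that is a multiple of a linear form vanishes.
  · suffices h : LinearMap.ker D = ⊥ by rw [h, finrank_bot]; exact Nat.zero_le _
    refine (Submodule.eq_bot_iff _).mpr fun f hf => ?_
    obtain ⟨e, he⟩ := hcross f hf
    refine Subtype.ext (funext fun i => Subtype.ext ?_)
    change (f.1 i : Ring3 k) = 0
    rw [← homogeneousComponent_eq_self (f.1 i).2.1, he i, mul_comm,
      homogeneousComponent_mul_of_isHomogeneous (isHomogeneous_linForm _),
      shiftComponent_of_lt one_pos, zero_mul]
  · rw [if_neg (Nat.succ_ne_zero t), Nat.add_sub_cancel]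
    let E : component (fatIdeal p (mDoublePrime m)) t →ₗ[k] (Fin 3 → Ring3 k) :=
      LinearMap.pi (fun i => LinearMap.mulLeft k (linForm (crossRow (p 0).rep i))) ∘ₗ
        (component _ t).subtype
    let F : LinearMap.ker D →ₗ[k] (Fin 3 → Ring3 k) :=
      LinearMap.pi (fun i => (component I (t + 1)).subtype ∘ₗ LinearMap.proj i) ∘ₗ N.subtype ∘ₗ
        (LinearMap.ker D).subtype
    have hF : Function.Injective F := by
      intro x y hxy
      refine Subtype.ext (Subtype.ext (funext fun i => Subtype.ext ?_))
      exact congrFun hxy i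
    have hFE : LinearMap.range F ≤ LinearMap.range E := by
      rintro _ ⟨f, rfl⟩
      obtain ⟨e, he⟩ := hcross f.1 f.2
      refine ⟨⟨e, mem_component_mDoublePrime hp fun i => ?_⟩, ?_⟩
      · rw [← he i]
        exact (f.1.1 i).2
      · funext i
        exact (he i).symm
    rw [← LinearMap.finrank_range_of_inj hF]
    exact (Submodule.finrank_mono hFE).trans (LinearMap.finrank_range_le E)

end Points

/-! ### Hasse derivatives and vanishing conditions in any characteristic. -/

/-- Polynomials in `Y` with coefficients in `k[X]` that are homogeneous of degree `t` in `X` and `Y`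
together. -/
def IsBihomogeneous (t : ℕ) (F : MvPolynomial (Fin 3) (Ring3 k)) : Prop :=
  ∀ b d : Fin 3 →₀ ℕ, coeff d (coeff b F) ≠ 0 → d.degree + b.degree = t

theorem IsBihomogeneous.mul {s t : ℕ} {F G : MvPolynomial (Fin 3) (Ring3 k)}
    (hF : IsBihomogeneous s F) (hG : IsBihomogeneous t G) : IsBihomogeneous (s + t) (F * G) := by
  intro b d h
  rw [coeff_mul, coeff_sum] at h
  obtain ⟨⟨b1, b2⟩, hb, h⟩ := Finset.exists_ne_zero_of_sum_ne_zero h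
  rw [coeff_mul] at h
  obtain ⟨⟨d1, d2⟩, hd, h⟩ := Finset.exists_ne_zero_of_sum_ne_zero h
  rw [Finset.HasAntidiagonal.mem_antidiagonal] at hb hd
  have h1 := hF _ _ (left_ne_zero_of_mul h)
  have h2 := hG _ _ (right_ne_zero_of_mul h)
  rw [← hb, ← hd, map_add, map_add]
  omega

theorem IsBihomogeneous.sum {ι : Type*} {s : Finset ι} {t : ℕ}
    {F : ι → MvPolynomial (Fin 3) (Ring3 k)} (hF : ∀ i ∈ s, IsBihomogeneous t (F i)) :
    IsBihomogeneous t (∑ i ∈ s, F i) := by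
  intro b d h
  rw [coeff_sum, coeff_sum] at h
  obtain ⟨i, hi, h⟩ := Finset.exists_ne_zero_of_sum_ne_zero h
  exact hF i hi b d h

theorem isBihomogeneous_C_C (c : k) : IsBihomogeneous 0 (C (C c)) := by
  intro b d h
  rw [coeff_C] at h
  split_ifs at h with hb
  · rw [coeff_C] at h
    split_ifs at h with hd
    · simp [← hb, ← hd]
    · exact absurd rfl h
  · simp at h

theorem isBihomogeneous_C_X_add_X (j : Fin 3) : IsBihomogeneous (k := k) 1 (C (X j) + X j) := by
  intro b d h
  rw [coeff_add, coeff_C, coeff_X, coeff_add] at h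
  by_cases hb : 0 = b
  · subst hb
    simp only [if_true, coeff_X] at h
    split_ifs at h with h1 h2
    · simp at h2
    · simp [← h1]
    · simp at *
    · simp at h
  · simp only [hb, if_false, coeff_zero, zero_add] at h
    split_ifs at h with h1
    · rw [coeff_one] at h
      split_ifs at h with h2
      · simp [← h1, ← h2]
      · exact absurd rfl h
    · simp at h

theorem IsBihomogeneous.pow {t : ℕ} {F : MvPolynomial (Fin 3) (Ring3 k)}
    (hF : IsBihomogeneous t F) (n : ℕ) : IsBihomogeneous (n * t) (F ^ n) := by
  induction n with
  | zero =>
    have := isBihomogeneous_C_C (1 : k)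
    simpa using this
  | succ n ih =>
    rw [pow_succ, Nat.succ_mul]
    exact ih.mul hF

theorem IsBihomogeneous.prod {ι : Type*} {s : Finset ι} {t : ι → ℕ}
    {F : ι → MvPolynomial (Fin 3) (Ring3 k)} (hF : ∀ i ∈ s, IsBihomogeneous (t i) (F i)) :
    IsBihomogeneous (∑ i ∈ s, t i) (∏ i ∈ s, F i) := by
  classical
  induction s using Finset.induction_on with
  | empty =>
    have := isBihomogeneous_C_C (1 : k)
    simpa using this
  | insert i s hi ih =>
    rw [Finset.prod_insert hi, Finset.sum_insert hi]
    exact (hF i (Finset.mem_insert_self _ _)).mul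
      (ih fun j hj => hF j (Finset.mem_insert_of_mem hj))

/-- The Taylor expansion `f (X + Y)` as a polynomial in `Y` with coefficients in `k[X]`. -/
noncomputable def taylor : Ring3 k →ₐ[k] MvPolynomial (Fin 3) (Ring3 k) :=
  aeval fun j => C (X j) + X j

theorem isBihomogeneous_taylor {f : Ring3 k} {t : ℕ} (hf : f.IsHomogeneous t) :
    IsBihomogeneous t (taylor f) := by
  rw [taylor, aeval_def, eval₂_eq]
  refine IsBihomogeneous.sum fun d hd => ?_
  have h1 : IsBihomogeneous (∑ i ∈ d.support, d i * 1)
      (∏ i ∈ d.support, (C (X i) + X i : MvPolynomial (Fin 3) (Ring3 k)) ^ d i) :=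
    IsBihomogeneous.prod fun i _ => (isBihomogeneous_C_X_add_X i).pow _
  have h2 := (isBihomogeneous_C_C (coeff d f)).mul h1
  have hd' : d.degree = t := by
    by_contra h
    exact mem_support_iff.mp hd (hf.coeff_eq_zero h)
  simpa [MvPolynomial.algebraMap_apply, ← Finsupp.degree_apply, hd'] using h2

/-- The Hasse derivative of `f` for the multi-index `b`. -/
noncomputable def hasse (b : Fin 3 →₀ ℕ) : Ring3 k →ₗ[k] Ring3 k :=
  (lcoeff (Ring3 k) b).restrictScalars k ∘ₗ taylor.toLinearMap

theorem hasse_apply (b : Fin 3 →₀ ℕ) (f : Ring3 k) : hasse b f = coeff b (taylor f) := rfl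

theorem isHomogeneous_hasse {f : Ring3 k} {t : ℕ} (hf : f.IsHomogeneous t) (b : Fin 3 →₀ ℕ) :
    (hasse b f).IsHomogeneous (t - b.degree) := by
  intro d hd
  have h1 := isBihomogeneous_taylor hf b d hd
  change Finsupp.weight (fun _ => 1) d = _
  rw [← Finsupp.degree_eq_weight_one]
  omega

theorem taylorAt_eq_map (v : Fin 3 → k) (f : Ring3 k) :
    taylorAt v f =
      map (aeval fun i => (Polynomial.X : Polynomial k) * Polynomial.C (v i)).toRingHom
        (taylor f) := by
  have : (taylorAt v).toRingHom =
      (map (aeval fun i => (Polynomial.X : Polynomial k) * Polynomial.C (v i)).toRingHom).comp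
        taylor.toRingHom := by
    refine MvPolynomial.ringHom_ext (fun r => ?_) fun i => ?_ <;>
      simp [taylorAt, taylor, MvPolynomial.algebraMap_apply]
  exact DFunLike.congr_fun this f

/-- A Hasse derivative of a form is a form, so along the line of `v` it is a power of the parameter
times its value at `v`. Vanishing to order `m` thus becomes polynomial conditions in the coordinates
of the point. -/
theorem le_ord_iff_hasse (v : Fin 3 → k) {f : Ring3 k} {t : ℕ} (hf : f.IsHomogeneous t) (m : ℕ) :
    (m : ℕ∞) ≤ ord v f ↔ ∀ b : Fin 3 →₀ ℕ, b.degree < m → eval v (hasse b f) = 0 := by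
  rw [le_ord_iff_coeff]
  refine forall₂_congr fun b _ => ?_
  rw [taylorAt_eq_map, coeff_map, ← hasse_apply]
  change aeval _ (hasse b f) = 0 ↔ _
  have h2 : (aeval fun i => Polynomial.C (v i)).toRingHom = Polynomial.C.comp (eval v) := by
    refine MvPolynomial.ringHom_ext (fun r => ?_) fun i => ?_ <;> simp
  have h2 : aeval (fun i => Polynomial.C (v i)) (hasse b f) = Polynomial.C (eval v (hasse b f)) :=
    DFunLike.congr_fun h2 _
  rw [aeval_mul_of_isHomogeneous (isHomogeneous_hasse hf b), h2]
  simp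

/-! ### Generic properties of tuples of points and semicontinuity. -/

section Multihomogeneous

variable {n : ℕ}

/-- Polynomials that are homogeneous of degree `d i` in the coordinates of the `i`-th point. -/
abbrev IsMultihomogeneous (F : MvPolynomial (Fin n × Fin 3) k) (d : Fin n → ℕ) : Prop :=
  F.IsWeightedHomogeneous (fun v : Fin n × Fin 3 => (Pi.single v.1 1 : Fin n → ℕ)) d

theorem IsMultihomogeneous.eval_mul {F : MvPolynomial (Fin n × Fin 3) k} {d : Fin n → ℕ}
    (hF : IsMultihomogeneous F d) (a : Fin n → k) (w : Fin n × Fin 3 → k) :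
    eval (fun v => a v.1 * w v) F = (∏ i, a i ^ d i) * eval w F := by
  rw [eval_eq, eval_eq, Finset.mul_sum]
  refine Finset.sum_congr rfl fun e he => ?_
  have h := hF (mem_support_iff.mp he)
  have h1 : ∏ i, a i ^ d i = ∏ v ∈ e.support, a v.1 ^ e v := by
    rw [← h]
    simp only [Finsupp.weight_apply, Finsupp.sum, Finset.sum_apply, Pi.smul_apply, smul_eq_mul,
      ← Finset.prod_pow_eq_pow_sum]
    rw [Finset.prod_comm]
    refine Finset.prod_congr rfl fun v _ => ?_
    rw [Finset.prod_eq_single v.1]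
    · simp
    · intro i _ hi
      simp [Pi.single_eq_of_ne hi]
    · simp
  rw [h1]
  simp only [mul_pow, Finset.prod_mul_distrib]
  ring

theorem isMultihomogeneous_rename {G : Ring3 k} {t : ℕ} (hG : G.IsHomogeneous t) (i : Fin n) :
    IsMultihomogeneous (rename (fun j => (i, j)) G) (Pi.single i t) := by
  intro e he
  obtain ⟨u, rfl, hu⟩ := coeff_rename_ne_zero _ _ _ he
  have hu' : u.degree = t := by
    by_contra h
    exact hu (hG.coeff_eq_zero h)
  rw [Finsupp.weight_apply, Finsupp.sum_mapDomain_index (by simp) (by simp [add_smul])]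
  funext l
  rw [Finsupp.sum, Finset.sum_apply]
  simp only [Pi.smul_apply, smul_eq_mul]
  rw [← Finset.sum_mul, ← Finsupp.degree_apply, hu']
  by_cases hl : l = i
  · subst hl; simp
  · simp [Pi.single_eq_of_ne hl]

/-- The property `P` of `n` points holds outside of a multihomogeneous hypersurface. -/
def Generic (P : (Fin n → Plane k) → Prop) : Prop :=
  ∃ F : MvPolynomial (Fin n × Fin 3) k, F ≠ 0 ∧ (∃ d, IsMultihomogeneous F d) ∧
    ∀ p : Fin n → Plane k, eval (fun v => (p v.1).rep v.2) F ≠ 0 → P p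

theorem Generic.mono {P Q : (Fin n → Plane k) → Prop} (h : Generic P) (hPQ : ∀ p, P p → Q p) :
    Generic Q := by
  obtain ⟨F, h0, hd, h⟩ := h
  exact ⟨F, h0, hd, fun p hp => hPQ p (h p hp)⟩

theorem Generic.and {P Q : (Fin n → Plane k) → Prop} (hP : Generic P) (hQ : Generic Q) :
    Generic fun p => P p ∧ Q p := by
  obtain ⟨F, hF0, ⟨d, hd⟩, hF⟩ := hP
  obtain ⟨G, hG0, ⟨e, he⟩, hG⟩ := hQ
  refine ⟨F * G, mul_ne_zero hF0 hG0, ⟨d + e, hd.mul he⟩, fun p hp => ?_⟩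
  rw [map_mul] at hp
  exact ⟨hF p (left_ne_zero_of_mul hp), hG p (right_ne_zero_of_mul hp)⟩

theorem generic_of_forall {P : (Fin n → Plane k) → Prop} (h : ∀ p, P p) : Generic P :=
  ⟨1, one_ne_zero, ⟨0, isWeightedHomogeneous_one _ _⟩, fun p _ => h p⟩

theorem generic_forall_mem {ι : Type*} (s : Finset ι) {P : ι → (Fin n → Plane k) → Prop}
    (h : ∀ i ∈ s, Generic (P i)) : Generic fun p => ∀ i ∈ s, P i p := by
  classical
  induction s using Finset.induction_on with
  | empty => exact generic_of_forall (by simp)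
  | insert i s hi ih =>
    refine ((h i (Finset.mem_insert_self _ _)).and
      (ih fun j hj => h j (Finset.mem_insert_of_mem hj))).mono fun p hp => ?_
    simpa using hp

theorem Generic.forGeneralPoints [Infinite k] {P : (Fin n → Plane k) → Prop} (h : Generic P) :
    ForGeneralPoints P := by
  obtain ⟨F, h0, ⟨d, hd⟩, h⟩ := h
  refine ⟨{p | eval (fun v => (p v.1).rep v.2) F ≠ 0}, ⟨{F}, ?_, ?_⟩, ?_, h⟩
  · rintro _ rfl
    exact ⟨d, hd⟩
  · ext p; simp
  -- The extra factor makes every block of coordinates of `w` nonzero, so that the blocks define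
  -- points.
  · have hG : F * ∏ i : Fin n, X (i, 0) ≠ 0 :=
      mul_ne_zero h0 (Finset.prod_ne_zero_iff.mpr fun i _ => X_ne_zero _)
    obtain ⟨w, hw⟩ : ∃ w, eval w (F * ∏ i : Fin n, X (i, 0)) ≠ 0 := by
      by_contra! hcon
      exact hG (MvPolynomial.funext fun w => by rw [hcon w, map_zero])
    rw [map_mul, map_prod] at hw
    have hw0 : ∀ i : Fin n, (fun j => w (i, j)) ≠ 0 := fun i hi => by
      refine right_ne_zero_of_mul hw (Finset.prod_eq_zero (Finset.mem_univ i) ?_)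
      rw [eval_X]
      exact congrFun hi 0
    choose a ha using fun i => Projectivization.exists_smul_eq_mk_rep k _ (hw0 i)
    refine ⟨fun i => Projectivization.mk k _ (hw0 i), ?_⟩
    have : (fun v : Fin n × Fin 3 => (Projectivization.mk k _ (hw0 v.1)).rep v.2) =
        fun v => (a v.1 : k) * w v := by
      funext v
      rw [← ha v.1]
      rfl
    have hev := IsMultihomogeneous.eval_mul hd (fun i => (a i : k)) w
    rw [Set.mem_ofPred_eq, this, hev]
    exact mul_ne_zero (Finset.prod_ne_zero_iff.mpr fun i _ => pow_ne_zero _ (a i).ne_zero)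
      (left_ne_zero_of_mul hw)

/-- A trivial kernel means that the rows span, so `c` of them form a basis. -/
theorem exists_det_ne_zero {ρ : Type*} {c : ℕ} (A : ρ → Fin c → k)
    (hA : ∀ x : Fin c → k, (∀ r, A r ⬝ᵥ x = 0) → x = 0) :
    ∃ s : Fin c → ρ, (Matrix.of fun i j => A (s i) j).det ≠ 0 := by
  have htop : Submodule.span k (Set.range A) = ⊤ := by
    by_contra hne
    obtain ⟨f, hf0, hf⟩ := Submodule.exists_le_ker_of_lt_top _ (lt_top_iff_ne_top.mpr hne)
    have hfe : ∀ y, f y = y ⬝ᵥ fun j => f (Pi.single j 1) := fun y => by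
      conv_lhs => rw [← LinearMap.sum_single_apply (fun _ => k) y, map_sum]
      refine Finset.sum_congr rfl fun j _ => ?_
      have : (Pi.single j (y j) : Fin c → k) = y j • Pi.single j 1 := by
        rw [← Pi.single_smul, smul_eq_mul, mul_one]
      rw [this, map_smul, smul_eq_mul]
    refine hf0 (LinearMap.ext fun y => ?_)
    have h0 := hA (fun j => f (Pi.single j 1)) fun r => by
      rw [← hfe]
      exact hf (Submodule.subset_span ⟨r, rfl⟩)
    rw [hfe y, h0, dotProduct_zero, LinearMap.zero_apply]
  have hex := Submodule.exists_fun_fin_finrank_span_eq k (Set.range A)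
  rw [htop, finrank_top, Module.finrank_fin_fun] at hex
  obtain ⟨f, hf, -, hind⟩ := hex
  choose s hs using hf
  refine ⟨s, ?_⟩
  have : (Matrix.of fun i j => A (s i) j) = Matrix.of f := by
    ext i j; simp [hs]
  rw [this]
  exact ((Matrix.isUnit_iff_isUnit_det _).mp
    (Matrix.linearIndependent_rows_iff_isUnit.mp hind)).ne_zero

/-- If the ideal of multiplicities `m` has no forms of degree `t` for some choice of points, it has
none for general points. -/
theorem generic_component_eq_bot {m : Fin n → ℕ} {t : ℕ} {p₀ : Fin n → Plane k}
    (h₀ : component (fatIdeal p₀ m) t = ⊥) :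
    Generic fun p : Fin n → Plane k => component (fatIdeal p m) t = ⊥ := by
  set c := Module.finrank k (homogeneousSubmodule (Fin 3) k t) with hc
  have B : Module.Basis (Fin c) k (homogeneousSubmodule (Fin 3) k t) := Module.finBasis k _
  clear_value c
  -- One linear condition for each point and each Hasse derivative of order below its multiplicity.
  let ρ := {r : Fin n × (Fin 3 →₀ ℕ) // r.2.degree < m r.1}
  let A : (Fin n → Plane k) → ρ → Fin c → k :=
    fun p r j => eval (p r.1.1).rep (hasse r.1.2 (B j))
  have key : ∀ p x, (∑ j, x j • (B j : Ring3 k)) ∈ fatIdeal p m ↔ ∀ r, A p r ⬝ᵥ x = 0 := by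
    intro p x
    have hhom : (∑ j, x j • (B j : Ring3 k)).IsHomogeneous t :=
      Submodule.sum_mem (homogeneousSubmodule (Fin 3) k t) fun j _ =>
        Submodule.smul_mem _ _ (B j).2
    have hev : ∀ i b, eval (p i).rep (hasse b (∑ j, x j • (B j : Ring3 k))) =
        (fun j => eval (p i).rep (hasse b (B j : Ring3 k))) ⬝ᵥ x := by
      intro i b
      simp [dotProduct, smul_eval, mul_comm]
    rw [mem_fatIdeal_iff]
    simp only [le_ord_iff_hasse _ hhom, hev]
    exact ⟨fun h r => h _ _ r.2, fun h i b hb => h ⟨(i, b), hb⟩⟩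
  have hinj : ∀ x, (∀ r, A p₀ r ⬝ᵥ x = 0) → x = 0 := by
    intro x hx
    have h1 : (∑ j, x j • B j : homogeneousSubmodule (Fin 3) k t) = 0 := by
      have h2 : (∑ j, x j • (B j : Ring3 k)) ∈ component (fatIdeal p₀ m) t :=
        ⟨Submodule.sum_mem _ fun j _ => Submodule.smul_mem _ _ (B j).2, (key p₀ x).mpr hx⟩
      rw [h₀, Submodule.mem_bot] at h2
      exact Subtype.ext (by simpa using h2)
    funext j
    exact Fintype.linearIndependent_iff.mp B.linearIndependent x h1 j
  -- This maximal minor is the required polynomial: wherever it is nonzero, the conditions still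
  -- have only the zero solution.
  obtain ⟨s, hs⟩ := exists_det_ne_zero (A p₀) hinj
  let M : Matrix (Fin c) (Fin c) (MvPolynomial (Fin n × Fin 3) k) :=
    Matrix.of fun i j => rename (fun l => ((s i).1.1, l)) (hasse (s i).1.2 (B j))
  have hM : ∀ p : Fin n → Plane k, eval (fun v => (p v.1).rep v.2) M.det =
      (Matrix.of fun i j => A p (s i) j).det := by
    intro p
    rw [RingHom.map_det]
    congr 1
    ext i j
    simp only [M, A, RingHom.mapMatrix_apply, Matrix.map_apply, Matrix.of_apply, eval_rename]
    rfl
  refine ⟨M.det, ?_, ⟨∑ i, Pi.single (s i).1.1 (t - (s i).1.2.degree), ?_⟩, ?_⟩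
  · intro h
    have := hM p₀
    rw [h, map_zero] at this
    exact hs this.symm
  -- After transposing, factor `i` of each term comes from row `i`, whose multidegree does not
  -- depend on the permutation.
  · rw [← Matrix.det_transpose, Matrix.det_apply]
    refine IsWeightedHomogeneous.sum _ _ _ fun τ _ => ?_
    have hprod : IsMultihomogeneous (∏ i, M.transpose (τ i) i)
        (∑ i, Pi.single (s i).1.1 (t - (s i).1.2.degree)) :=
      IsWeightedHomogeneous.prod _ _ _ fun i _ =>
        isMultihomogeneous_rename (isHomogeneous_hasse (B (τ i)).2 _) _
    rw [Units.smul_def, ← Int.cast_smul_eq_zsmul k]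
    exact Submodule.smul_mem (weightedHomogeneousSubmodule k _ _) _ hprod
  · intro p hp
    rw [hM] at hp
    refine (Submodule.eq_bot_iff _).mpr fun f hf => ?_
    have hf' := congrArg Subtype.val (B.sum_repr ⟨f, hf.1⟩)
    simp only [Submodule.coe_sum, Submodule.coe_smul] at hf'
    have hx := (key p (fun j => B.repr ⟨f, hf.1⟩ j)).mp (by rw [hf']; exact hf.2)
    have hzero := Matrix.eq_zero_of_mulVec_eq_zero hp (funext fun i => hx (s i))
    rw [← hf']
    exact Finset.sum_eq_zero fun j _ => by rw [congrFun hzero j]; simp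

theorem generic_ne {i j : Fin n} (hij : i ≠ j) : Generic fun p : Fin n → Plane k => p i ≠ p j := by
  have hX : ∀ a b : Fin 3, IsMultihomogeneous (X (i, a) * X (j, b) : MvPolynomial (Fin n × Fin 3) k)
      (Pi.single i 1 + Pi.single j 1) := fun a b =>
    (isWeightedHomogeneous_X k _ (i, a)).mul (isWeightedHomogeneous_X k _ (j, b))
  refine ⟨X (i, 0) * X (j, 1) - X (i, 1) * X (j, 0), ?_, ⟨_, (hX 0 1).sub (hX 1 0)⟩, ?_⟩
  · intro h
    have := congrArg (eval fun v => if v = (i, 0) ∨ v = (j, 1) then (1 : k) else 0) h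
    simp [hij] at this
  · intro p hp h
    refine hp ?_
    simp [h]
    ring

end Multihomogeneous

/-! ### Maximal rank of multiplication in the initial degree. -/

section

variable {n : ℕ} {p : Fin n → Plane k} {m : Fin n → ℕ}

theorem fatIdeal_comp (σ : Equiv.Perm (Fin n)) (p : Fin n → Plane k) (m : Fin n → ℕ) :
    fatIdeal (p ∘ σ) (m ∘ σ) = fatIdeal p m :=
  σ.iInf_congr fun _ => rfl

theorem Unhindered.two_mul_hilb_of_pos (h : Unhindered p m) {t : ℕ}
    (ht : 0 < hilb (fatIdeal p m) t) :
    2 * (hilb (fatIdeal p m) t : ℤ) = ((t : ℤ) + 1) * (t + 2) - ∑ i, (m i : ℤ) * (m i + 1) :=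
  (h.eq_or t).resolve_left fun h1 => ht.ne' h1.1

variable [NeZero n]

theorem finrank_ker_mulMap_alpha_le (hp : ∀ i ≠ 0, p i ≠ p 0) :
    Module.finrank k (LinearMap.ker (mulMap (fatIdeal p m) (alpha (fatIdeal p m)))) ≤
      qNum p m + lNum p m :=
  finrank_ker_mulMap_le hp _

theorem ker_mulMap_eq_bot_of_qNum_of_lNum (hp : ∀ i ≠ 0, p i ≠ p 0) (hq : qNum p m = 0)
    (hl : lNum p m = 0) :
    LinearMap.ker (mulMap (fatIdeal p m) (alpha (fatIdeal p m))) = ⊥ := by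
  have h := finrank_ker_mulMap_alpha_le hp (m := m)
  rw [hq, hl, Nat.le_zero] at h
  exact Submodule.finrank_eq_zero.mp h

/-- No syzygies of degree one in degree `t` if raising the multiplicity at either of two points
kills all forms of degree `t`. -/
theorem ker_mulMap_eq_bot_of_swap {i : Fin n} (hi : p i ≠ p 0) (hm : m 0 = m i) {t : ℕ}
    (h0 : component (fatIdeal p (mPrime m)) t = ⊥)
    (h1 : component (fatIdeal (p ∘ Equiv.swap 0 i) (mPrime m)) t = ⊥) :
    LinearMap.ker (mulMap (fatIdeal p m) t) = ⊥ := by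
  have hσ : fatIdeal (p ∘ Equiv.swap 0 i) m = fatIdeal p m := by
    have : m ∘ Equiv.swap 0 i = m := by
      rw [Equiv.comp_swap_eq_update, ← hm, Function.update_eq_self_iff.mpr,
        Function.update_eq_self_iff.mpr hm] <;> simp [hm]
    rw [← fatIdeal_comp (Equiv.swap 0 i) p m, this]
  refine (Submodule.eq_bot_iff _).mpr fun f hf => ?_
  have hX := LinearMap.mem_ker.mp hf
  have e0 := sum_rep_mul_mem_component hX
  rw [h0, Submodule.mem_bot] at e0
  have hX' : mulMap (fatIdeal (p ∘ Equiv.swap 0 i) m) t (fun j => ⟨f j, by rw [hσ]; exact (f j).2⟩)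
      = 0 := by
    rw [mulMap_apply] at hX ⊢
    exact hX
  have e1 := sum_rep_mul_mem_component hX'
  rw [h1, Submodule.mem_bot, Function.comp_apply, Equiv.swap_apply_left] at e1
  rw [mulMap_apply] at hX
  obtain ⟨e, he⟩ := exists_eq_crossRow_mul (p 0).rep_nonzero hX e0
  obtain ⟨l, hl⟩ := exists_crossRow_dotProduct_ne_zero hi.symm
  -- The linear factor is the equation of the line through `p 0` and `p i`.
  have hmul : (∑ j, C ((p i).rep j) * linForm (crossRow (p 0).rep j)) * e = 0 := by
    rw [← e1, Finset.sum_mul]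
    exact Finset.sum_congr rfl fun j _ => by rw [he j, mul_assoc]
  have hne : ∑ j, C ((p i).rep j) * linForm (crossRow (p 0).rep j) ≠ 0 := by
    intro h
    have := congrArg (coeff (Finsupp.single l 1)) h
    simp only [coeff_sum, coeff_C_mul, coeff_linForm, coeff_zero] at this
    apply hl
    -- The sign reflects the skew symmetry of the matrix `crossRow`.
    rw [← neg_eq_zero, ← this]
    fin_cases l <;> (simp [crossRow, dotProduct, Fin.sum_univ_three]; ring)
  have he0 := (mul_eq_zero.mp hmul).resolve_left hne
  exact funext fun j => Subtype.ext (by rw [he j, he0, mul_zero]; rfl)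

theorem sum_update (m : Fin n → ℕ) (c : ℕ) :
    ∑ i, (Function.update m 0 c i : ℤ) * (Function.update m 0 c i + 1) =
      ∑ i, (m i : ℤ) * (m i + 1) - m 0 * (m 0 + 1) + c * (c + 1) := by
  rw [← Finset.add_sum_erase _ _ (Finset.mem_univ (0 : Fin n)),
    ← Finset.add_sum_erase _ (fun i => (m i : ℤ) * (m i + 1)) (Finset.mem_univ (0 : Fin n))]
  have : ∑ i ∈ Finset.univ.erase 0, (Function.update m 0 c i : ℤ) * (Function.update m 0 c i + 1) =
      ∑ i ∈ Finset.univ.erase 0, (m i : ℤ) * (m i + 1) :=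
    Finset.sum_congr rfl fun i hi => by
      rw [Function.update_of_ne (Finset.ne_of_mem_erase hi)]
  rw [this, Function.update_self]
  ring

/-- As `q` and `l` are positive, both equal their expected values: `q = h - (m_1 + 1)` and `l = h -
(α + 1) + m_1`. Their sum `2h - (α + 2)` bounds the kernel, so the rank is at least `3h - (q + l) =
h_I(α+1)`. -/
theorem le_finrank_range_mulMap (hp : ∀ i ≠ 0, p i ≠ p 0) (h : Unhindered p m)
    (h' : Unhindered p (mPrime m)) (h'' : Unhindered p (mDoublePrime m))
    (hq : 0 < qNum p m) (hl : 0 < lNum p m) :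
    hilb (fatIdeal p m) (alpha (fatIdeal p m) + 1) ≤
      Module.finrank k (LinearMap.range (mulMap (fatIdeal p m) (alpha (fatIdeal p m)))) := by
  have hker := finrank_ker_mulMap_alpha_le hp (m := m)
  have hsum := LinearMap.finrank_range_add_finrank_ker
    (mulMap (fatIdeal p m) (alpha (fatIdeal p m)))
  rw [finrank_mulMap_domain] at hsum
  have hsucc := h.hilb_succ le_rfl
  have hα := h.two_mul_hilb le_rfl
  have hq' := h'.two_mul_hilb_of_pos hq
  have hα0 : alpha (fatIdeal p m) ≠ 0 := fun h0 => by simp [lNum, h0] at hl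
  have hlNum : lNum p m = hilb (fatIdeal p (mDoublePrime m)) (alpha (fatIdeal p m) - 1) :=
    if_neg hα0
  -- If `m 0` were zero, `I''` would be `I`, which has no forms below `alpha`. So the truncated
  -- subtraction in `mDoublePrime` is exact here.
  have hm0 : m 0 ≠ 0 := fun h0 => by
    have hm : mDoublePrime m = m := by simp [mDoublePrime, h0]
    rw [hlNum, hm, (hilb_eq_zero_iff _ _).mpr (component_eq_bot_of_lt p m (by omega))] at hl
    exact lt_irrefl _ hl
  have hl' := h''.two_mul_hilb_of_pos (hlNum ▸ hl)
  rw [← hlNum] at hl'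
  change 2 * (qNum p m : ℤ) = _ at hq'
  rw [mPrime, sum_update] at hq'
  rw [mDoublePrime, sum_update] at hl'
  have hαc : ((alpha (fatIdeal p m) - 1 : ℕ) : ℤ) = alpha (fatIdeal p m) - 1 := by omega
  have hmc : ((m 0 - 1 : ℕ) : ℤ) = m 0 - 1 := by omega
  rw [hαc, hmc] at hl'
  push_cast at hq'
  have key : (qNum p m : ℤ) + lNum p m =
      2 * hilb (fatIdeal p m) (alpha (fatIdeal p m)) - (alpha (fatIdeal p m) + 2) := by
    linarith
  omega

end

/-! ### The open set of points and the conclusion. -/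

/-- The degree `alpha` depends on the points, so all degrees up to the bound `∑ m_i` are treated at
once. For each `t`, either no points make the component zero and the implication is vacuous, or some
do and semicontinuity, applied to the relabelled points, gives the conclusion generically. -/
theorem generic_swap {n : ℕ} [NeZero n] (m : Fin n → ℕ) (i : Fin n) :
    Generic fun p : Fin n → Plane k => ∀ t ∈ Finset.range (∑ i, m i + 1),
      component (fatIdeal p (mPrime m)) t = ⊥ →
        component (fatIdeal (p ∘ Equiv.swap 0 i) (mPrime m)) t = ⊥ := by
  refine generic_forall_mem _ fun t _ => ?_
  have hσ : ∀ p : Fin n → Plane k, fatIdeal (p ∘ Equiv.swap 0 i) (mPrime m) =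
      fatIdeal p (mPrime m ∘ Equiv.swap 0 i) := fun p => by
    rw [← fatIdeal_comp (Equiv.swap 0 i) p]
    congr 1
    funext j
    simp
  by_cases h : ∃ p₀ : Fin n → Plane k, component (fatIdeal p₀ (mPrime m)) t = ⊥
  · obtain ⟨p₀, h₀⟩ := h
    have h₁ : component (fatIdeal (p₀ ∘ Equiv.swap 0 i) (mPrime m ∘ Equiv.swap 0 i)) t = ⊥ := by
      rwa [fatIdeal_comp]
    refine (generic_component_eq_bot h₁).mono fun p hp _ => ?_
    rwa [hσ]
  · exact generic_of_forall fun p hp => absurd ⟨p, hp⟩ h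

theorem forGeneralPoints_rankMinimal (k : Type*) [Field k] [IsAlgClosed k] (n : ℕ) [NeZero n]
    (m : Fin n → ℕ) :
    ForGeneralPoints (k := k) (fun p : Fin n → Plane k =>
      Unhindered p m →
        (qNum p m = 0 → lNum p m = 0 → RankMinimal p m) ∧
        (∀ hn : 1 < n, m 0 = m ⟨1, hn⟩ →
          qNum p m = 0 → RankMinimal p m) ∧
        (∀ hn : 1 < n, m 0 = m ⟨1, hn⟩ → 0 < lNum p m →
          Unhindered p (mPrime m) →
          Unhindered p (mDoublePrime m) →
          RankMinimal p m)) := by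
  have : Infinite k := IsAlgClosed.instInfinite
  have h1 : Generic fun p : Fin n → Plane k => ∀ i ∈ Finset.univ.erase 0, p i ≠ p 0 :=
    generic_forall_mem _ fun i hi => generic_ne (Finset.ne_of_mem_erase hi)
  have h2 : Generic fun p : Fin n → Plane k => ∀ i ∈ Finset.univ.erase 0,
      ∀ t ∈ Finset.range (∑ i, m i + 1), component (fatIdeal p (mPrime m)) t = ⊥ →
        component (fatIdeal (p ∘ Equiv.swap 0 i) (mPrime m)) t = ⊥ :=
    generic_forall_mem _ fun i _ => generic_swap m i
  refine ((h1.and h2).mono fun p hp hun => ?_).forGeneralPoints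
  have hne : ∀ i ≠ 0, p i ≠ p 0 := fun i hi => hp.1 i (by simp [hi])
  have hb : ∀ hn : 1 < n, m 0 = m ⟨1, hn⟩ → qNum p m = 0 → RankMinimal p m := by
    intro hn hm hq
    have h10 : (⟨1, hn⟩ : Fin n) ≠ 0 := fun h => by simp [Fin.ext_iff] at h
    have hbot := (hilb_eq_zero_iff _ _).mp hq
    exact hun.rankMinimal (Or.inl (ker_mulMap_eq_bot_of_swap (hne _ h10) hm hbot
      (hp.2 _ (by simp) _
        (Finset.mem_range.mpr (Nat.lt_succ_of_le (alpha_le_sum p m))) hbot)))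
  refine ⟨fun hq hl => hun.rankMinimal (Or.inl (ker_mulMap_eq_bot_of_qNum_of_lNum hne hq hl)), hb,
    fun hn hm hl h' h'' => ?_⟩
  rcases Nat.eq_zero_or_pos (qNum p m) with hq | hq
  · exact hb hn hm hq
  · exact hun.rankMinimal (Or.inr (le_finrank_range_mulMap hne hun h' h'' hq hl))

end FatPoints

theorem lemma2p6 (k : Type*) [Field k] [IsAlgClosed k] (n : ℕ) [NeZero n] (m : Fin n → ℕ) :
    FatPoints.ForGeneralPoints (k := k) (fun p : Fin n → FatPoints.Plane k =>
      FatPoints.Unhindered p m →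
        (FatPoints.qNum p m = 0 → FatPoints.lNum p m = 0 → FatPoints.RankMinimal p m) ∧
        (∀ hn : 1 < n, m 0 = m ⟨1, hn⟩ →
          FatPoints.qNum p m = 0 → FatPoints.RankMinimal p m) ∧
        (∀ hn : 1 < n, m 0 = m ⟨1, hn⟩ → 0 < FatPoints.lNum p m →
          FatPoints.Unhindered p (FatPoints.mPrime m) →
          FatPoints.Unhindered p (FatPoints.mDoublePrime m) →
          FatPoints.RankMinimal p m)) :=
  FatPoints.forGeneralPoints_rankMinimal k n m
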